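/- Let $H$ be a complex Hilbert space, not necessarily separable, with $\dim H\ge 2$ (for instance $H=\mathbb{C}^2$). Let $\mathcal{E}(H)$ be the set of all bounded self-adjoint operators $A$ on $H$ with $0\le A\le I$ (the effects), ordered by $A\le B$ if and only if $\langle Ax,x\rangle\le\langle Bx,x\rangle$ for all $x\in H$. Call two effects $A,B$ coexistent, written $A\sim B$, if there are effects $E,F,G$ such that $A=E+G$, $B=F+G$ and $E+F+G\in\mathcal{E}(H)$. Call a map $\phi\colon\mathcal{E}(H)\to\mathcal{E}(H)$ a standard automorphism if there is a unitary or antiunitary operator $U\colon H\to H$ such that $\phi(A)=UAU^*$ for all $A\in\mathcal{E}(H)$. If $\phi\colon\mathcal{E}(H)\to\mathcal{E}(H)$ is a bijection such that, for all $A,B\in\mathcal{E}(H)$, $$A\le B\iff\phi(A)\le\phi(B)\qquad\text{and}\qquad A\sim B\iff\phi(A)\sim\phi(B),$$ then $\phi$ is a standard automorphism. Conversely, every standard automorphism $\phi$ of $\mathcal{E}(H)$ satisfies both of these equivalences for all $A,B\in\mathcal{E}(H)$. -/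

import Mathlib

/-- The effect algebra of a complex Hilbert space `H`: the operator interval `[0, I]`, i.e. all
self-adjoint bounded operators `A` on `H` with `0 ≤ A ≤ I`. The order on operators is Mathlib's
Loewner order, so for effects `A ≤ B` holds iff `⟨A x, x⟩ ≤ ⟨B x, x⟩` for all `x`. As a subtype of
the bounded operators, `Effect H` carries the induced order. -/
abbrev Effect (H : Type*) [NormedAddCommGroup H] [InnerProductSpace ℂ H] [CompleteSpace H] :
    Type _ :=
  {A : H →L[ℂ] H // IsSelfAdjoint A ∧ 0 ≤ A ∧ A ≤ 1}

/-- Two effects `A`, `B` are coexistent if there are effects `E`, `F`, `G` with `A = E + G`,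
`B = F + G` and such that `E + F + G` is again an effect (called `S` here). -/
def Coexistent {H : Type*} [NormedAddCommGroup H] [InnerProductSpace ℂ H] [CompleteSpace H]
    (A B : Effect H) : Prop :=
  ∃ E F G S : Effect H,
    (A : H →L[ℂ] H) = E + G ∧ (B : H →L[ℂ] H) = F + G ∧ (S : H →L[ℂ] H) = E + F + G

/-- A map on the effect algebra is a standard automorphism if it is `A ↦ U A U*` for some unitary
or antiunitary operator `U` on `H`. A unitary (antiunitary) operator is a surjective linear
(conjugate-linear) isometry of `H`, and its adjoint `U*` is its inverse `U.symm`. -/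
def IsStandardAutomorphism {H : Type*} [NormedAddCommGroup H] [InnerProductSpace ℂ H]
    [CompleteSpace H] (φ : Effect H → Effect H) : Prop :=
  (∃ U : H ≃ₗᵢ[ℂ] H, ∀ (A : Effect H) (x : H),
      (φ A : H →L[ℂ] H) x = U ((A : H →L[ℂ] H) (U.symm x))) ∨
  (∃ U : H ≃ₛₗᵢ[starRingEnd ℂ] H, ∀ (A : Effect H) (x : H),
      (φ A : H →L[ℂ] H) x = U ((A : H →L[ℂ] H) (U.symm x)))

/-! Write `P_x` for the projection onto the line of a unit vector `x`. Order singles out the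
multiples `t P_x` (`ray t x`): they are exactly the effects whose lower set is a chain. Coexistence
singles out the scalars: they are exactly the effects coexistent with everything. Hence an
automorphism `e` sends `P_x` to some `P_{Tx}` and `t • 1` to `k t • 1`. Since `t P_x` is the infimum
of `t • 1` and `P_x`, it goes to `k t` times `P_{Tx}`.

For distinct lines, `s P_x` and `t P_y` coexist iff `s t c ≤ (1 - s)(1 - t)`, where `c = |⟨x, y⟩|²`
(`coexistent_ray_iff`). In logit coordinates this is a half-plane `u + v ≤ -log c`, so `k` becomes
an affine map `α u + β` and `c` becomes `K c ^ α` with `K = exp (-2β)`. If `x` lies in the span of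
orthogonal `y` and `z`, a relation expressible by order, the two transition probabilities sum to 1
both before and after. This forces `α = K = 1` (`eq_self_of_mul_mul_le_iff`). So `k` is the
identity, `T` preserves transition probabilities, and Wigner's theorem supplies `U`. An effect is
determined by the multiples of projections below it, so agreement on these gives `e A = U A U*`
everywhere. -/

/-! ### Wigner's theorem on maps preserving transition amplitudes -/

section Wigner

open Complex ComplexConjugate

variable {H : Type*} [NormedAddCommGroup H] [InnerProductSpace ℂ H]

local notation "⟪" x ", " y "⟫" => inner ℂ x y

theorem norm_inner_self_eq_norm_mul_norm (x : H) : ‖⟪x, x⟫‖ = ‖x‖ * ‖x‖ := by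
  rw [inner_self_eq_norm_sq_to_K]; simp [sq]

theorem norm_map_eq_of_norm_inner_eq {T : H → H} (hT : ∀ x y, ‖⟪T x, T y⟫‖ = ‖⟪x, y⟫‖) (x : H) :
    ‖T x‖ = ‖x‖ := by
  have := hT x x
  rw [norm_inner_self_eq_norm_mul_norm, norm_inner_self_eq_norm_mul_norm] at this
  exact (mul_self_inj (norm_nonneg _) (norm_nonneg _)).1 this

theorem exists_unit_smul_of_norm_inner_eq {u v : H} (huv : ‖u‖ = ‖v‖)
    (h : ‖⟪v, u⟫‖ = ‖v‖ * ‖u‖) : ∃ c : ℂ, ‖c‖ = 1 ∧ u = c • v := by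
  by_cases hv : v = 0
  · subst hv
    exact ⟨1, by simp, by simpa using huv⟩
  · have hu : u ≠ 0 := by
      rw [← norm_ne_zero_iff, huv, norm_ne_zero_iff]; exact hv
    obtain ⟨c, -, hc⟩ := (norm_inner_eq_norm_iff (𝕜 := ℂ) hv hu).1 h
    refine ⟨c, ?_, hc⟩
    have h1 : ‖c‖ * ‖v‖ = ‖v‖ := by rw [← norm_smul, ← hc, huv]
    exact mul_right_cancel₀ (norm_ne_zero_iff.2 hv) (by rw [h1, one_mul])

/-- A map with the same real inner products as an additive map is additive. -/
theorem map_add_of_re_inner_eq {W p : H → H} (hp : ∀ x y, p (x + y) = p x + p y)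
    (h : ∀ x y, (⟪W x, W y⟫).re = (⟪p x, p y⟫).re) (x y : H) : W (x + y) = W x + W y := by
  have key : ∀ a b c : H, ‖a - (b + c)‖ ^ 2 =
      (⟪a, a⟫).re + (⟪b, b⟫).re + (⟪c, c⟫).re - 2 * (⟪a, b⟫).re - 2 * (⟪a, c⟫).re
        + 2 * (⟪b, c⟫).re := by
    intro a b c
    rw [@norm_sub_sq ℂ, @norm_add_sq ℂ, inner_add_right, ← inner_self_eq_norm_sq (𝕜 := ℂ),
      ← inner_self_eq_norm_sq (𝕜 := ℂ), ← inner_self_eq_norm_sq (𝕜 := ℂ)]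
    simp only [RCLike.re_to_complex, add_re]
    ring
  -- The squared norm involves only real inner products, so it equals the same expression in `p`,
  -- which vanishes.
  have h0 : ‖W (x + y) - (W x + W y)‖ ^ 2 = 0 := by
    rw [key, h, h, h, h, h, h, ← key, hp]
    simp
  exact sub_eq_zero.1 (norm_eq_zero.1 (by simpa using h0))

theorem map_real_smul_of_re_inner_eq {W p : H → H}
    (hp : ∀ (t : ℝ) x, p ((t : ℂ) • x) = (t : ℂ) • p x)
    (h : ∀ x y, (⟪W x, W y⟫).re = (⟪p x, p y⟫).re) (t : ℝ) (x : H) :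
    W ((t : ℂ) • x) = (t : ℂ) • W x := by
  have key : ∀ a b : H, ‖a - (t : ℂ) • b‖ ^ 2 =
      (⟪a, a⟫).re + t ^ 2 * (⟪b, b⟫).re - 2 * (t * (⟪a, b⟫).re) := by
    intro a b
    rw [@norm_sub_sq ℂ, inner_smul_right, norm_smul, mul_pow, norm_real, Real.norm_eq_abs, sq_abs,
      ← inner_self_eq_norm_sq (𝕜 := ℂ), ← inner_self_eq_norm_sq (𝕜 := ℂ)]
    simp only [RCLike.re_to_complex, re_ofReal_mul]
    ring
  have h0 : ‖W ((t : ℂ) • x) - (t : ℂ) • W x‖ ^ 2 = 0 := by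
    rw [key, h, h, h, ← key, hp]
    simp
  exact sub_eq_zero.1 (norm_eq_zero.1 (by simpa using h0))

/-- Equality in Cauchy-Schwarz makes `u` a unit multiple of `v`, and the vanishing real part leaves
only the phases `± I`. This is where the linear and conjugate-linear cases separate. -/
theorem eq_I_smul_or_of_inner {u v : H} (huv : ‖u‖ = ‖v‖) (hre : (⟪u, v⟫).re = 0)
    (h : ‖⟪u, v⟫‖ = ‖v‖ ^ 2) : u = I • v ∨ u = -(I • v) := by
  obtain ⟨c, hc, rfl⟩ := exists_unit_smul_of_norm_inner_eq huv (by
    rw [norm_inner_symm, h, huv, sq])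
  by_cases hv : v = 0
  · simp [hv]
  have hv' : (0 : ℝ) < ‖v‖ ^ 2 := by positivity
  rw [inner_smul_left, inner_self_eq_norm_sq_to_K] at hre
  have hc0 : c.re = 0 := by
    have : c.re * ‖v‖ ^ 2 = 0 := by
      rw [← hre]
      simp [← ofReal_pow]
    exact (mul_eq_zero.1 this).resolve_right hv'.ne'
  have hc1 : c.im ^ 2 = 1 := by
    have := Complex.sq_norm c
    rw [hc, normSq_apply, hc0] at this
    linarith [this]
  rcases (sq_eq_sq_iff_eq_or_eq_neg.1 (hc1.trans (one_pow 2).symm)) with h1 | h1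
  · left; rw [show c = I from Complex.ext (by simp [hc0]) (by simp [h1])]
  · right; rw [show c = -I from Complex.ext (by simp [hc0]) (by simp [h1]), neg_smul]

/-- A map that satisfies `f (I • x) = ± I • f x` pointwise does so with a constant sign. -/
theorem map_I_smul_const_sign {W : H → H} (hadd : ∀ x y, W (x + y) = W x + W y)
    (h : ∀ x, W (I • x) = I • W x ∨ W (I • x) = -(I • W x)) :
    (∀ x, W (I • x) = I • W x) ∨ (∀ x, W (I • x) = -(I • W x)) := by
  by_contra! hcon
  obtain ⟨⟨x, hx⟩, ⟨y, hy⟩⟩ := hcon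
  have hx' := (h x).resolve_left hx
  have hy' := (h y).resolve_right hy
  rcases h (x + y) with h1 | h1
  · rw [smul_add, hadd, hadd, hy', smul_add] at h1
    exact hx (add_right_cancel h1)
  · rw [smul_add, hadd, hadd, hx', smul_add, neg_add] at h1
    exact hy (add_left_cancel h1)

/-- If `T` preserves transition amplitudes, then `e + y ↦ T (e + y)`, suitably rephased, induces a
map on the orthogonal complement of `e` that preserves real inner products. -/
theorem exists_map_orthogonal_of_norm_inner_eq {T : H → H} (hT : ∀ x y, ‖⟪T x, T y⟫‖ = ‖⟪x, y⟫‖)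
    {e : H} (he : ‖e‖ = 1) :
    ∃ V : H → H, ∀ y, ⟪e, y⟫ = 0 → ⟪T e, V y⟫ = 0 ∧ (∃ a : ℂ, ‖a‖ = 1 ∧ T e + V y = a • T (e + y)) ∧
      (∃ c : ℂ, ‖c‖ = 1 ∧ V y = c • T y) ∧ ∀ z, ⟪e, z⟫ = 0 →
        (⟪V y, V z⟫).re = (⟪y, z⟫).re := by
  have hn : ∀ x, ‖T x‖ = ‖x‖ := norm_map_eq_of_norm_inner_eq hT
  have hee : ⟪e, e⟫ = 1 := by rw [inner_self_eq_norm_sq_to_K, he]; simp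
  have hTe : ⟪T e, T e⟫ = 1 := by rw [inner_self_eq_norm_sq_to_K, hn, he]; simp
  let a : H → ℂ := fun y => ⟪T e, T (e + y)⟫
  have ha : ∀ y, ⟪e, y⟫ = 0 → ‖a y‖ = 1 := fun y hy => by
    simp only [a]
    rw [hT, inner_add_right, hy, hee]; simp
  -- Dividing by the phase `a y` makes the component of `T (e + y)` along `T e` equal to `T e`; `V
  -- y` is the rest.
  let V : H → H := fun y => (a y)⁻¹ • T (e + y) - T e
  have hVa : ∀ y, T e + V y = (a y)⁻¹ • T (e + y) := fun y => by simp [V]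
  have hV0 : ∀ y, ⟪e, y⟫ = 0 → ⟪T e, V y⟫ = 0 := fun y hy => by
    have h0 : a y ≠ 0 := by rw [← norm_ne_zero_iff, ha y hy]; exact one_ne_zero
    have : (a y)⁻¹ * ⟪T e, T (e + y)⟫ = 1 := inv_mul_cancel₀ h0
    simp only [V]
    rw [inner_sub_right, inner_smul_right, hTe, this, sub_self]
  have hV0' : ∀ y, ⟪e, y⟫ = 0 → ⟪V y, T e⟫ = 0 := fun y hy => inner_eq_zero_symm.1 (hV0 y hy)
  have h1 : ∀ y z, ⟪e, y⟫ = 0 → ⟪e, z⟫ = 0 → ‖1 + ⟪V y, V z⟫‖ = ‖1 + ⟪y, z⟫‖ := by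
    intro y z hy hz
    have h2 : ⟪T e + V y, T e + V z⟫ = 1 + ⟪V y, V z⟫ := by
      simp only [inner_add_left, inner_add_right, hTe, hV0 z hz, hV0' y hy]; ring
    have h3 : ⟪e + y, e + z⟫ = 1 + ⟪y, z⟫ := by
      simp only [inner_add_left, inner_add_right, hee, hz, inner_eq_zero_symm.1 hy]; ring
    rw [← h2, ← h3, hVa, hVa, inner_smul_left, inner_smul_right, norm_mul, norm_mul, hT]
    simp [ha y hy, ha z hz]
  have hVn : ∀ y, ⟪e, y⟫ = 0 → ‖V y‖ = ‖y‖ := by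
    intro y hy
    have h2 := h1 y y hy hy
    rw [inner_self_eq_norm_sq_to_K, inner_self_eq_norm_sq_to_K] at h2
    have h3 : ∀ r : ℝ, ‖(1 : ℂ) + (r : ℂ) ^ 2‖ = 1 + r ^ 2 := fun r => by
      rw [show (1 : ℂ) + (r : ℂ) ^ 2 = ((1 + r ^ 2 : ℝ) : ℂ) by push_cast; ring, norm_real,
        Real.norm_of_nonneg (by positivity)]
    have h4 : 1 + ‖V y‖ ^ 2 = 1 + ‖y‖ ^ 2 := by rw [← h3, ← h3]; exact h2
    exact (sq_eq_sq₀ (norm_nonneg _) (norm_nonneg _)).1 (by linarith)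
  have hVT : ∀ y, ⟪e, y⟫ = 0 → ∃ c : ℂ, ‖c‖ = 1 ∧ V y = c • T y := by
    intro y hy
    refine exists_unit_smul_of_norm_inner_eq ((hVn y hy).trans (hn y).symm) ?_
    have h2 : ⟪T y, T e⟫ = 0 := by
      rw [← norm_eq_zero, hT, norm_eq_zero]; exact inner_eq_zero_symm.1 hy
    have h3 : ⟪y, e + y⟫ = (‖y‖ : ℂ) ^ 2 := by
      rw [inner_add_right, inner_eq_zero_symm.1 hy, zero_add]; exact inner_self_eq_norm_sq_to_K y
    simp only [V]
    rw [inner_sub_right, h2, sub_zero, inner_smul_right, norm_mul, hT, h3, norm_inv, ha y hy]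
    have := hVn y hy
    simp only [V] at this
    rw [this, hn]
    simp [sq]
  refine ⟨V, fun y hy => ⟨hV0 y hy, ⟨(a y)⁻¹, by simp [ha y hy], hVa y⟩, hVT y hy, ?_⟩⟩
  intro z hz
  have h2 : ‖⟪V y, V z⟫‖ = ‖⟪y, z⟫‖ := by
    obtain ⟨c, hc, h⟩ := hVT y hy
    obtain ⟨d, hd, h'⟩ := hVT z hz
    rw [h, h', inner_smul_left, inner_smul_right, norm_mul, norm_mul, hT]
    simp [hc, hd]
  -- The moduli of `u` and of `1 + u` determine the real part of `u`.
  have h3 : ∀ u : ℂ, ‖1 + u‖ ^ 2 = 1 + 2 * u.re + ‖u‖ ^ 2 := fun u => by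
    rw [Complex.sq_norm, Complex.sq_norm, normSq_apply, normSq_apply]
    simp
    ring
  have h4 := h3 ⟪V y, V z⟫
  rw [h1 y z hy hz, h2, h3] at h4
  linarith

/-- Assembling a (conjugate-)linear isometry from a (conjugate-)linear map `W` that vanishes on `e`
and is isometric on its orthogonal complement. -/
theorem exists_semilinearIsometryEquiv_of_map_orthogonal {σ σ' : ℂ →+* ℂ} [RingHomInvPair σ σ']
    [RingHomInvPair σ' σ] [RingHomIsometric σ] {T W : H → H} {e : H} (he : ‖e‖ = 1)
    (hT : ∀ x y, ‖⟪T x, T y⟫‖ = ‖⟪x, y⟫‖)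
    (hsurj : ∀ z, ∃ (c : ℂ) (x : H), z = c • T x)
    (hadd : ∀ x y, W (x + y) = W x + W y) (hsmul : ∀ (c : ℂ) x, W (c • x) = σ c • W x)
    (hW0 : ∀ x, ⟪T e, W x⟫ = 0) (hWn : ∀ x, ‖W x‖ = ‖x - ⟪e, x⟫ • e‖)
    (hW1 : ∀ y, ⟪e, y⟫ = 0 → ∃ a : ℂ, ‖a‖ = 1 ∧ T e + W y = a • T (e + y))
    (hW2 : ∀ y, ⟪e, y⟫ = 0 → ∃ a : ℂ, ‖a‖ = 1 ∧ W y = a • T y) :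
    ∃ U : H ≃ₛₗᵢ[σ] H, ∀ x, ∃ c : ℂ, ‖c‖ = 1 ∧ U x = c • T x := by
  have hn : ∀ x, ‖T x‖ = ‖x‖ := norm_map_eq_of_norm_inner_eq hT
  have hσ : ∀ c, ‖σ c‖ = ‖c‖ := fun c => RingHomIsometric.norm_map
  have hee : ⟪e, e⟫ = 1 := by rw [inner_self_eq_norm_sq_to_K, he]; simp
  have horth : ∀ x, ⟪e, x - ⟪e, x⟫ • e⟫ = 0 := fun x => by
    rw [inner_sub_right, inner_smul_right, hee, mul_one, sub_self]
  have hWe : W e = 0 := by rw [← norm_eq_zero, hWn, hee]; simp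
  have hpyth : ∀ (c : ℂ) (f w : H), ‖f‖ = 1 → ⟪f, w⟫ = 0 →
      ‖c • f + w‖ * ‖c • f + w‖ = ‖c‖ * ‖c‖ + ‖w‖ * ‖w‖ := by
    intro c f w hf hw
    rw [norm_add_sq_eq_norm_sq_add_norm_sq_of_inner_eq_zero (𝕜 := ℂ) _ _
      (by rw [inner_smul_left, hw, mul_zero]), norm_smul, hf, mul_one]
  let L : H →ₛₗ[σ] H :=
    { toFun := fun x => σ ⟪e, x⟫ • T e + W x
      map_add' := fun x y => by
        rw [inner_add_right, map_add, add_smul, hadd]; abel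
      map_smul' := fun c x => by
        rw [inner_smul_right, map_mul, hsmul, smul_add, smul_smul] }
  have hL : ∀ x, L x = σ ⟪e, x⟫ • T e + W x := fun _ => rfl
  have hLn : ∀ x, ‖L x‖ = ‖x‖ := by
    intro x
    rw [← mul_self_inj (norm_nonneg _) (norm_nonneg _), hL,
      hpyth _ _ _ ((hn e).trans he) (hW0 x), hσ, hWn, ← hpyth _ _ _ he (horth x),
      add_sub_cancel]
  have hLT : ∀ x, ∃ c : ℂ, ‖c‖ = 1 ∧ L x = c • T x := by
    intro x
    by_cases hx : ⟪e, x⟫ = 0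
    · obtain ⟨c, hc, h⟩ := hW2 x hx
      exact ⟨c, hc, by rw [hL, hx, map_zero, zero_smul, zero_add, h]⟩
    -- Off the complement of `e`, rescaling brings `x` to the form `e + y`, where `hW1` applies; the
    -- phases do not affect the modulus.
    · refine exists_unit_smul_of_norm_inner_eq ((hLn x).trans (hn x).symm) ?_
      set l := ⟪e, x⟫ with hl
      set y := l⁻¹ • (x - l • e) with hy
      have hxy : x = l • (e + y) := by
        rw [hy, smul_add, smul_smul, mul_inv_cancel₀ hx, one_smul, add_sub_cancel]
      have hey : ⟪e, y⟫ = 0 := by rw [hy, inner_smul_right, horth, mul_zero]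
      obtain ⟨a, ha, h⟩ := hW1 y hey
      have hLx : L x = (σ l * a) • T (e + y) := by
        rw [hxy, LinearMap.map_smulₛₗ, hL, inner_add_right, hee, hey, add_zero, map_one, one_smul,
          hadd, hWe, zero_add, h, smul_smul]
      rw [hLn, hn, hLx, inner_smul_right, norm_mul, norm_mul, hσ, ha, mul_one, hT, ← norm_mul,
        ← inner_smul_right, ← hxy, norm_inner_self_eq_norm_mul_norm]
  let Li : H →ₛₗᵢ[σ] H := ⟨L, hLn⟩
  have hs : Function.Surjective Li := by
    intro z
    obtain ⟨c, x, rfl⟩ := hsurj z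
    obtain ⟨d, hd, h⟩ := hLT x
    have hd0 : d ≠ 0 := by rw [← norm_ne_zero_iff, hd]; exact one_ne_zero
    refine ⟨σ' (c * d⁻¹) • x, ?_⟩
    change L _ = _
    rw [LinearMap.map_smulₛₗ, h, smul_smul, RingHomInvPair.comp_apply_eq₂, mul_assoc,
      inv_mul_cancel₀ hd0, mul_one]
  exact ⟨LinearIsometryEquiv.ofSurjective Li hs, hLT⟩

/-- **Wigner's theorem**. -/
theorem wigner {T : H → H} {e : H} (he : ‖e‖ = 1) (hT : ∀ x y, ‖⟪T x, T y⟫‖ = ‖⟪x, y⟫‖)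
    (hsurj : ∀ z, ∃ (c : ℂ) (x : H), z = c • T x) :
    (∃ U : H ≃ₗᵢ[ℂ] H, ∀ x, ∃ c : ℂ, ‖c‖ = 1 ∧ U x = c • T x) ∨
      (∃ U : H ≃ₛₗᵢ[starRingEnd ℂ] H, ∀ x, ∃ c : ℂ, ‖c‖ = 1 ∧ U x = c • T x) := by
  obtain ⟨V, hV⟩ := exists_map_orthogonal_of_norm_inner_eq hT he
  have hn : ∀ x, ‖T x‖ = ‖x‖ := norm_map_eq_of_norm_inner_eq hT
  have hee : ⟪e, e⟫ = 1 := by rw [inner_self_eq_norm_sq_to_K, he]; simp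
  let p : H → H := fun x => x - ⟪e, x⟫ • e
  have horth : ∀ x, ⟪e, p x⟫ = 0 := fun x => by
    simp only [p]
    rw [inner_sub_right, inner_smul_right, hee, mul_one, sub_self]
  have hp : ∀ y, ⟪e, y⟫ = 0 → p y = y := fun y hy => by simp [p, hy]
  have hpadd : ∀ x y, p (x + y) = p x + p y := fun x y => by
    simp only [p, inner_add_right, add_smul]; abel
  have hpsmul : ∀ (c : ℂ) x, p (c • x) = c • p x := fun c x => by
    simp only [p, inner_smul_right, smul_sub, smul_smul]
  let W : H → H := fun x => V (p x)
  have hre : ∀ x y, (⟪W x, W y⟫).re = (⟪p x, p y⟫).re := fun x y =>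
    (hV _ (horth x)).2.2.2 _ (horth y)
  have hadd := map_add_of_re_inner_eq hpadd hre
  have hreal := map_real_smul_of_re_inner_eq (fun t x => hpsmul t x) hre
  have hWT : ∀ x, ∃ c : ℂ, ‖c‖ = 1 ∧ W x = c • T (p x) := fun x => (hV _ (horth x)).2.2.1
  have hWn : ∀ x, ‖W x‖ = ‖p x‖ := fun x => by
    obtain ⟨c, hc, h⟩ := hWT x
    rw [h, norm_smul, hc, one_mul, hn]
  -- `⟨p (I • x), p x⟩` is purely imaginary, and its modulus survives because `W` is `T ∘ p` up to
  -- phases.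
  have hI : ∀ x, W (I • x) = I • W x ∨ W (I • x) = -(I • W x) := by
    intro x
    refine eq_I_smul_or_of_inner ?_ ?_ ?_
    · rw [hWn, hWn, hpsmul, norm_smul]; simp
    · rw [hre, hpsmul, inner_smul_left, inner_self_eq_norm_sq_to_K]
      simp [← ofReal_pow]
    · obtain ⟨c, hc, h⟩ := hWT x
      obtain ⟨d, hd, h'⟩ := hWT (I • x)
      rw [hWn, h, h', inner_smul_left, inner_smul_right, norm_mul, norm_mul, hT, hpsmul,
        inner_smul_left, norm_mul, norm_inner_self_eq_norm_mul_norm]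
      simp [hc, hd, sq]
  have hW0 : ∀ x, ⟪T e, W x⟫ = 0 := fun x => (hV _ (horth x)).1
  have hW1 : ∀ y, ⟪e, y⟫ = 0 → ∃ a : ℂ, ‖a‖ = 1 ∧ T e + W y = a • T (e + y) := fun y hy => by
    simp only [W, hp y hy]; exact (hV y hy).2.1
  have hW2 : ∀ y, ⟪e, y⟫ = 0 → ∃ a : ℂ, ‖a‖ = 1 ∧ W y = a • T y := fun y hy => by
    simp only [W, hp y hy]; exact (hV y hy).2.2.1
  rcases map_I_smul_const_sign hadd hI with h | h
  · left
    refine exists_semilinearIsometryEquiv_of_map_orthogonal he hT hsurj hadd (fun c x => ?_)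
      hW0 hWn hW1 hW2
    conv_lhs => rw [← re_add_im c, add_smul, hadd, hreal, mul_smul, hreal, h]
    conv_rhs => rw [RingHom.id_apply, ← re_add_im c, add_smul, mul_smul]
  · right
    refine exists_semilinearIsometryEquiv_of_map_orthogonal he hT hsurj hadd (fun c x => ?_)
      hW0 hWn hW1 hW2
    have hc : starRingEnd ℂ c = (c.re : ℂ) + (c.im : ℂ) * -I := by
      apply Complex.ext <;> simp
    conv_lhs => rw [← re_add_im c, add_smul, hadd, hreal, mul_smul, hreal, h]
    rw [hc, add_smul, mul_smul, neg_smul]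

end Wigner

/-! ### The functional equation for the action on scalars -/

section FunctionalEquation

open Set Real

/-- The boundary line `x + y = a` must map to the boundary, so `h x + h y` depends only on `x + y`
when this is positive. Hence `h - h 0` is additive; it is continuous, being monotone with `h` onto,
and so linear. -/
theorem exists_eq_mul_add_of_add_le_iff {h : ℝ → ℝ} (hmono : StrictMono h)
    (hsurj : Function.Surjective h)
    (hh : ∀ a, 0 < a → ∃ a', ∀ x y, x + y ≤ a ↔ h x + h y ≤ a') :
    ∃ α β : ℝ, 0 < α ∧ ∀ x, h x = α * x + β := by
  have h1 : ∀ x y, 0 < x + y → h x + h y = h (x + y) + h 0 := by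
    have : ∀ a, 0 < a → ∃ a', ∀ x y, x + y = a → h x + h y = a' := by
      intro a ha
      obtain ⟨a', h'⟩ := hh a ha
      -- If the value fell below `a'`, surjectivity would allow `y` to be raised to some `w` with `x
      -- + w ≤ a` still forced.
      refine ⟨a', fun x y hxy => le_antisymm ((h' x y).1 hxy.le) ?_⟩
      by_contra! hlt
      obtain ⟨w, hw⟩ := hsurj (a' - h x)
      have h2 : y < w := hmono.lt_iff_lt.1 (by linarith)
      have h3 := (h' x w).2 (by linarith)
      linarith
    intro x y hxy
    obtain ⟨a', h'⟩ := this _ hxy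
    rw [h' x y rfl, h' (x + y) 0 (add_zero _)]
  have h2 : ∀ x y, h (x + y) - h 0 = (h x - h 0) + (h y - h 0) := by
    intro x y
    -- A shift large enough to make every sum below positive.
    set M := |x + y| + |y| + 1 with hM
    have e1 := h1 (x + y) M (by linarith [neg_abs_le (x + y), abs_nonneg y])
    have e2 := h1 y M (by linarith [neg_abs_le y, abs_nonneg (x + y)])
    have e3 := h1 x (y + M) (by linarith [neg_abs_le (x + y), abs_nonneg y])
    rw [show x + (y + M) = x + y + M by ring] at e3
    linarith
  have hc : Continuous h := hmono.monotone.continuous_of_surjective hsurj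
  let j : ℝ →+ ℝ := AddMonoidHom.mk' (fun x => h x - h 0) h2
  have hj : ∀ x, h x - h 0 = x * (h 1 - h 0) := by
    intro x
    have := (j.toRealLinearMap (hc.sub continuous_const)).map_smul x 1
    rw [smul_eq_mul, mul_one, smul_eq_mul] at this
    exact this
  refine ⟨h 1 - h 0, h 0, sub_pos.2 (hmono one_pos), fun x => ?_⟩
  linarith [hj x]

theorem sigmoid_mul_mul_le_iff {c : ℝ} (hc : 0 < c) (x y : ℝ) :
    sigmoid x * sigmoid y * c ≤ (1 - sigmoid x) * (1 - sigmoid y) ↔ x + y ≤ -log c := by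
  rw [← sigmoid_neg, ← sigmoid_neg, ← sigmoid_mul_rexp_neg, ← sigmoid_mul_rexp_neg,
    mul_mul_mul_comm, ← exp_add, mul_le_mul_iff_right₀ (mul_pos (sigmoid_pos x) (sigmoid_pos y)),
    ← log_le_iff_le_exp hc]
  constructor <;> intro h <;> linarith

/-- The limit `c → 0` gives `K = 1`; then `c = 1/2` gives `α = 1`. -/
theorem eq_one_of_rpow_add_rpow {α K : ℝ} (hα : 0 < α)
    (h : ∀ c ∈ Ioo (0 : ℝ) 1, K * (c ^ α + (1 - c) ^ α) = 1) : α = 1 ∧ K = 1 := by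
  have hcont : Continuous fun c : ℝ => K * (c ^ α + (1 - c) ^ α) := by
    have h1 := continuous_rpow_const hα.le
    exact continuous_const.mul (h1.add (h1.comp (continuous_const.sub continuous_id)))
  have hK : K = 1 := by
    have hclosed : IsClosed {c : ℝ | K * (c ^ α + (1 - c) ^ α) = 1} :=
      isClosed_eq hcont continuous_const
    have h0 : (0 : ℝ) ∈ closure (Ioo (0 : ℝ) 1) := by
      rw [closure_Ioo zero_ne_one]; simp
    have := hclosed.closure_subset_iff.2 (fun c hc => h c hc) h0
    simpa [zero_rpow hα.ne'] using this
  refine ⟨?_, hK⟩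
  have h2 := h (1 / 2) (by norm_num)
  rw [hK, show (1 : ℝ) - 1 / 2 = 1 / 2 by norm_num] at h2
  have h3 : (1 / 2 : ℝ) ^ α = (1 / 2) ^ (1 : ℝ) := by rw [rpow_one]; linarith
  have h4 := congrArg log h3
  rw [log_rpow (by norm_num), log_rpow (by norm_num)] at h4
  exact mul_right_cancel₀ (log_neg (by norm_num) (by norm_num)).ne h4

theorem eq_self_of_mul_mul_le_iff {k : ℝ → ℝ} (hmaps : MapsTo k (Icc 0 1) (Icc 0 1))
    (hmono : StrictMonoOn k (Icc 0 1)) (hsurj : SurjOn k (Icc 0 1) (Icc 0 1))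
    (hk : ∀ c ∈ Ioo (0 : ℝ) 1, ∃ c' d' : ℝ, c' + d' = 1 ∧
      (∀ s ∈ Icc (0 : ℝ) 1, ∀ t ∈ Icc (0 : ℝ) 1,
        s * t * c ≤ (1 - s) * (1 - t) ↔ k s * k t * c' ≤ (1 - k s) * (1 - k t)) ∧
      (∀ s ∈ Icc (0 : ℝ) 1, ∀ t ∈ Icc (0 : ℝ) 1,
        s * t * (1 - c) ≤ (1 - s) * (1 - t) ↔ k s * k t * d' ≤ (1 - k s) * (1 - k t))) :
    ∀ t ∈ Icc (0 : ℝ) 1, k t = t := by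
  have m0 : (0 : ℝ) ∈ Icc (0 : ℝ) 1 := by simp
  have m1 : (1 : ℝ) ∈ Icc (0 : ℝ) 1 := by simp
  have k0 : k 0 = 0 := by
    obtain ⟨s, hs, h⟩ := hsurj m0
    exact le_antisymm (h ▸ hmono.monotoneOn m0 hs hs.1) (hmaps m0).1
  have k1 : k 1 = 1 := by
    obtain ⟨s, hs, h⟩ := hsurj m1
    exact le_antisymm (hmaps m1).2 (h.symm.trans_le (hmono.monotoneOn hs m1 hs.2))
  have msig : ∀ x, sigmoid x ∈ Icc (0 : ℝ) 1 := fun x => ⟨sigmoid_nonneg x, sigmoid_le_one x⟩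
  have hex : ∀ x, ∃ y, sigmoid y = k (sigmoid x) := by
    intro x
    have : k (sigmoid x) ∈ Ioo (0 : ℝ) 1 :=
      ⟨k0 ▸ hmono m0 (msig x) (sigmoid_pos x), k1 ▸ hmono (msig x) m1 (sigmoid_lt_one x)⟩
    rwa [← range_sigmoid] at this
  choose h hh using hex
  have hhmono : StrictMono h := fun x y hxy => by
    rw [← sigmoid_lt_iff, hh, hh]
    exact hmono (msig x) (msig y) (sigmoid_lt hxy)
  have hhsurj : Function.Surjective h := by
    intro y
    obtain ⟨s, hs, hsy⟩ := hsurj (msig y)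
    have : s ∈ range sigmoid := by
      rw [range_sigmoid]
      refine ⟨hs.1.lt_of_ne ?_, hs.2.lt_of_ne ?_⟩
      · rintro rfl; exact (sigmoid_pos y).ne (k0.symm.trans hsy)
      · rintro rfl; exact (sigmoid_lt_one y).ne (hsy.symm.trans k1)
    obtain ⟨x, rfl⟩ := this
    exact ⟨x, sigmoid_injective ((hh x).trans hsy)⟩
  have key : ∀ c c' : ℝ, 0 < c → (∀ s ∈ Icc (0 : ℝ) 1, ∀ t ∈ Icc (0 : ℝ) 1,
        s * t * c ≤ (1 - s) * (1 - t) ↔ k s * k t * c' ≤ (1 - k s) * (1 - k t)) →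
      0 < c' ∧ ∀ x y, x + y ≤ -log c ↔ h x + h y ≤ -log c' := by
    intro c c' hc hcc
    -- At `s = t = 1` the right-hand condition reads `c' ≤ 0`, the left-hand one `c ≤ 0`.
    have hc' : 0 < c' := by
      by_contra! hle
      have := (hcc 1 m1 1 m1).2 (by rw [k1]; linarith)
      linarith
    refine ⟨hc', fun x y => ?_⟩
    rw [← sigmoid_mul_mul_le_iff hc, ← sigmoid_mul_mul_le_iff hc', hh, hh]
    exact hcc _ (msig x) _ (msig y)
  obtain ⟨α, β, hα, hαβ⟩ := exists_eq_mul_add_of_add_le_iff hhmono hhsurj (fun a ha => by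
    -- The probabilities `c < 1` are the thresholds `a = -log c > 0`.
    have hc : exp (-a) ∈ Ioo (0 : ℝ) 1 := ⟨exp_pos _, by rw [← exp_zero]; exact exp_lt_exp.2 (by linarith)⟩
    obtain ⟨c', d', -, h1, -⟩ := hk _ hc
    have := (key _ _ hc.1 h1).2
    rw [log_exp, neg_neg] at this
    exact ⟨_, this⟩)
  have key2 : ∀ c c' : ℝ, 0 < c → (∀ s ∈ Icc (0 : ℝ) 1, ∀ t ∈ Icc (0 : ℝ) 1,
        s * t * c ≤ (1 - s) * (1 - t) ↔ k s * k t * c' ≤ (1 - k s) * (1 - k t)) →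
      c' = exp (-(2 * β)) * c ^ α := by
    intro c c' hc hcc
    obtain ⟨hc', hxy⟩ := key c c' hc hcc
    -- One boundary point of each half-plane is tested, giving the two inequalities between `c'` and
    -- `exp (-(2 * β)) * c ^ α`.
    have h1 := (hxy (-log c) 0).1 (by simp)
    rw [hαβ, hαβ] at h1
    have h2 := (hxy ((-log c' - 2 * β) / α) 0).2 (by
      rw [hαβ, hαβ, mul_div_cancel₀ _ hα.ne']; linarith)
    rw [add_zero, div_le_iff₀ hα] at h2
    rw [rpow_def_of_pos hc, ← exp_add, ← exp_log hc']
    congr 1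
    linarith
  obtain ⟨rfl, hK⟩ := eq_one_of_rpow_add_rpow (K := exp (-(2 * β))) hα (fun c hc => by
    obtain ⟨c', d', hcd, h1, h2⟩ := hk c hc
    rw [mul_add, ← key2 _ _ hc.1 h1, ← key2 _ _ (by linarith [hc.2]) h2, hcd])
  have hβ : β = 0 := by
    have := (exp_eq_one_iff _).1 hK
    linarith
  intro t ht
  rcases ht.1.eq_or_lt with rfl | h0
  · exact k0
  rcases ht.2.eq_or_lt with rfl | h1
  · exact k1
  have : t ∈ range sigmoid := by rw [range_sigmoid]; exact ⟨h0, h1⟩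
  obtain ⟨x, rfl⟩ := this
  rw [← hh, hαβ, hβ, one_mul, add_zero]

theorem eq_of_mul_mul_le_iff {c c' : ℝ} (hc : 0 ≤ c) (hc' : 0 ≤ c')
    (h : ∀ s ∈ Icc (0 : ℝ) 1, ∀ t ∈ Icc (0 : ℝ) 1,
      s * t * c ≤ (1 - s) * (1 - t) ↔ s * t * c' ≤ (1 - s) * (1 - t)) : c = c' := by
  have key : ∀ c c' : ℝ, 0 ≤ c → 0 ≤ c' → (∀ s ∈ Icc (0 : ℝ) 1, ∀ t ∈ Icc (0 : ℝ) 1,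
      s * t * c ≤ (1 - s) * (1 - t) → s * t * c' ≤ (1 - s) * (1 - t)) → c' ≤ c := by
    intro c c' hc hc' h
    have hpos : 0 < 1 + c := by linarith
    -- This pair gives equality in the condition for `c`.
    have h1 := h (1 / 2) (by norm_num) (1 / (1 + c))
      ⟨by positivity, by rw [div_le_one hpos]; linarith⟩
    have e : 1 - 1 / (1 + c) = c / (1 + c) := by field_simp; ring
    rw [e] at h1
    have h2 := h1 (le_of_eq (by ring))
    have h3 : (1 / (1 + c)) * c' ≤ (1 / (1 + c)) * c := by
      have : (1 / (1 + c)) * c = c / (1 + c) := by ring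
      rw [this]
      linarith
    exact le_of_mul_le_mul_left h3 (by positivity)
  exact le_antisymm (key _ _ hc' hc fun s hs t ht => (h s hs t ht).2)
    (key _ _ hc hc' fun s hs t ht => (h s hs t ht).1)

end FunctionalEquation

/-! ### Multiples of rank-one projections and their order-theoretic characterization -/

section Effects

open Complex ComplexConjugate Metric

variable {H : Type*} [NormedAddCommGroup H] [InnerProductSpace ℂ H]

local notation "⟪" x ", " y "⟫" => inner ℂ x y

namespace Effect

theorem re_inner_smul_rankOne (t : ℝ) (x y : H) :
    (⟪((t : ℂ) • InnerProductSpace.rankOne ℂ x x) y, y⟫).re = t * ‖⟪x, y⟫‖ ^ 2 := by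
  rw [smul_apply, InnerProductSpace.rankOne_apply, inner_smul_left,
    inner_smul_left, conj_ofReal, re_ofReal_mul, ← normSq_eq_conj_mul_self, ofReal_re,
    normSq_eq_norm_sq]

theorem inner_coe_self (x : sphere (0 : H) 1) : ⟪(x : H), (x : H)⟫ = 1 := by
  rw [inner_self_eq_norm_sq_to_K]; simp

theorem norm_inner_coe_le_one (x y : sphere (0 : H) 1) : ‖⟪(x : H), (y : H)⟫‖ ≤ 1 := by
  simpa using norm_inner_le_norm (𝕜 := ℂ) (x : H) y

variable [CompleteSpace H]

/-- The effect given by a symmetric operator whose quadratic form lies between `0` and `‖x‖ ^ 2`. -/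
def ofForm (T : H →L[ℂ] H) (hT : ∀ x y, ⟪T x, y⟫ = ⟪x, T y⟫) (h0 : ∀ x, 0 ≤ (⟪T x, x⟫).re)
    (h1 : ∀ x, (⟪T x, x⟫).re ≤ ‖x‖ ^ 2) : Effect H :=
  ⟨T, ContinuousLinearMap.isSelfAdjoint_iff_isSymmetric.2 hT,
    (ContinuousLinearMap.nonneg_iff_isPositive T).2 ⟨hT, h0⟩,
    (ContinuousLinearMap.le_def T 1).2 ⟨fun x y => by
        have := hT x y
        simpa [inner_sub_left, inner_sub_right] using this, fun x => by
      have h2 : (⟪x, x⟫).re = ‖x‖ ^ 2 := inner_self_eq_norm_sq (𝕜 := ℂ) x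
      have h3 := h1 x
      simp only [ContinuousLinearMap.reApplyInnerSelf_apply, sub_apply,
        one_apply_eq_self, inner_sub_left, RCLike.re_to_complex, sub_re, h2]
      linarith⟩⟩

theorem inner_symm (A : Effect H) (x y : H) : ⟪A.1 x, y⟫ = ⟪x, A.1 y⟫ :=
  ContinuousLinearMap.isSelfAdjoint_iff_isSymmetric.1 A.2.1 x y

theorem re_inner_nonneg (A : Effect H) (x : H) : 0 ≤ (⟪A.1 x, x⟫).re :=
  ((ContinuousLinearMap.nonneg_iff_isPositive _).1 A.2.2.1).re_inner_nonneg_left x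

theorem le_iff {A B : Effect H} : A ≤ B ↔ ∀ x, (⟪A.1 x, x⟫).re ≤ (⟪B.1 x, x⟫).re := by
  rw [← Subtype.coe_le_coe, ContinuousLinearMap.le_def, ContinuousLinearMap.isPositive_def]
  constructor
  · intro h x
    have := h.2 x
    simpa [ContinuousLinearMap.reApplyInnerSelf_apply, inner_sub_left] using this
  · refine fun h => ⟨fun x y => ?_, fun x => ?_⟩
    · have hA := A.inner_symm x y
      have hB := B.inner_symm x y
      simp [inner_sub_left, inner_sub_right, hA, hB]
    · have := h x
      simpa [ContinuousLinearMap.reApplyInnerSelf_apply, inner_sub_left] using this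

theorem ext_form {A B : Effect H} (h : ∀ x, (⟪A.1 x, x⟫).re = (⟪B.1 x, x⟫).re) : A = B :=
  le_antisymm (le_iff.2 fun x => (h x).le) (le_iff.2 fun x => (h x).ge)

theorem re_inner_le (A : Effect H) (x : H) : (⟪A.1 x, x⟫).re ≤ ‖x‖ ^ 2 := by
  have h2 : (⟪x, x⟫).re = ‖x‖ ^ 2 := inner_self_eq_norm_sq (𝕜 := ℂ) x
  have := ((ContinuousLinearMap.le_def _ _).1 A.2.2.2).re_inner_nonneg_left x
  simp only [sub_apply, one_apply_eq_self, inner_sub_left,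
    RCLike.re_to_complex, sub_re, h2] at this
  linarith

theorem inner_self_eq_re (A : Effect H) (x : H) : ⟪A.1 x, x⟫ = ((⟪A.1 x, x⟫).re : ℂ) := by
  refine (conj_eq_iff_re.1 ?_).symm
  rw [inner_conj_symm, ← A.inner_symm]

/-- The Cauchy-Schwarz inequality for the form of an effect. -/
theorem norm_inner_sq_le (A : Effect H) (x y : H) :
    ‖⟪A.1 x, y⟫‖ ^ 2 ≤ (⟪A.1 x, x⟫).re * (⟪A.1 y, y⟫).re := by
  set S := CFC.sqrt A.1 with hS
  have hSS : S * S = A.1 := CFC.sqrt_mul_sqrt_self _ A.2.2.1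
  have hSsa : ∀ x y, ⟪S x, y⟫ = ⟪x, S y⟫ :=
    ContinuousLinearMap.isSelfAdjoint_iff_isSymmetric.1 (IsSelfAdjoint.of_nonneg (CFC.sqrt_nonneg _))
  have h : ∀ x y, ⟪A.1 x, y⟫ = ⟪S x, S y⟫ := fun x y => by
    rw [← hSS, mul_apply_eq_comp, hSsa]
  have h' : ∀ x, (⟪S x, S x⟫).re = ‖S x‖ ^ 2 := fun x => inner_self_eq_norm_sq (𝕜 := ℂ) _
  rw [h, h, h, h', h', ← mul_pow]
  gcongr
  exact norm_inner_le_norm _ _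

theorem apply_eq_zero_of_re_inner_eq_zero (A : Effect H) {x : H} (h : (⟪A.1 x, x⟫).re = 0) :
    A.1 x = 0 := by
  have := A.norm_inner_sq_le x (A.1 x)
  rw [h, zero_mul, norm_inner_self_eq_norm_mul_norm] at this
  have h2 : ‖A.1 x‖ * ‖A.1 x‖ = 0 := by nlinarith [sq_nonneg (‖A.1 x‖ * ‖A.1 x‖)]
  simpa using h2

/-- The scalar effect `t • 1`. -/
def scalar (t : unitInterval) : Effect H :=
  ofForm ((t : ℂ) • (1 : H →L[ℂ] H))
    (fun x y => by simp)
    (fun x => by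
      have h2 : (⟪x, x⟫).re = ‖x‖ ^ 2 := inner_self_eq_norm_sq (𝕜 := ℂ) x
      simp only [smul_apply, one_apply_eq_self, inner_smul_left,
        conj_ofReal, re_ofReal_mul, h2]
      exact mul_nonneg t.2.1 (sq_nonneg _))
    (fun x => by
      have h2 : (⟪x, x⟫).re = ‖x‖ ^ 2 := inner_self_eq_norm_sq (𝕜 := ℂ) x
      simp only [smul_apply, one_apply_eq_self, inner_smul_left,
        conj_ofReal, re_ofReal_mul, h2]
      exact mul_le_of_le_one_left (sq_nonneg _) t.2.2)

theorem scalar_apply (t : unitInterval) (x : H) : (scalar t : Effect H).1 x = (t : ℂ) • x := rfl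

theorem re_inner_scalar (t : unitInterval) (x : H) :
    (⟪(scalar t : Effect H).1 x, x⟫).re = t * ‖x‖ ^ 2 := by
  have h2 : (⟪x, x⟫).re = ‖x‖ ^ 2 := inner_self_eq_norm_sq (𝕜 := ℂ) x
  rw [scalar_apply, inner_smul_left, conj_ofReal, re_ofReal_mul, h2]

/-- The effect `t • P`, where `P` is the projection onto the line through the unit vector `x`. -/
noncomputable def ray (t : unitInterval) (x : sphere (0 : H) 1) : Effect H :=
  ofForm ((t : ℂ) • InnerProductSpace.rankOne ℂ (x : H) (x : H))
    (fun y z => by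
      simp only [smul_apply, InnerProductSpace.rankOne_apply, inner_smul_left,
        inner_smul_right, conj_ofReal, inner_conj_symm]
      ring)
    (fun y => by
      rw [re_inner_smul_rankOne]
      exact mul_nonneg t.2.1 (sq_nonneg _))
    (fun y => by
      rw [re_inner_smul_rankOne]
      have h1 : ‖⟪(x : H), y⟫‖ ≤ ‖y‖ := by simpa using norm_inner_le_norm (𝕜 := ℂ) (x : H) y
      calc _ ≤ 1 * ‖⟪(x : H), y⟫‖ ^ 2 := by gcongr; exact t.2.2
        _ ≤ ‖y‖ ^ 2 := by rw [one_mul]; gcongr)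

theorem ray_apply (t : unitInterval) (x : sphere (0 : H) 1) (y : H) :
    (ray t x).1 y = (t * ⟪(x : H), y⟫ : ℂ) • (x : H) := by
  rw [mul_smul]; rfl

theorem re_inner_ray (t : unitInterval) (x : sphere (0 : H) 1) (y : H) :
    (⟪(ray t x).1 y, y⟫).re = t * ‖⟪(x : H), y⟫‖ ^ 2 := re_inner_smul_rankOne _ _ _

theorem re_inner_ray_self (t : unitInterval) (x : sphere (0 : H) 1) :
    (⟪(ray t x).1 x, (x : H)⟫).re = t := by
  rw [re_inner_ray, inner_coe_self]; simp

theorem ray_le_ray_iff {s t : unitInterval} {x : sphere (0 : H) 1} : ray s x ≤ ray t x ↔ s ≤ t := by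
  refine ⟨fun h => ?_, fun h => le_iff.2 fun y => ?_⟩
  · have := le_iff.1 h x
    rwa [re_inner_ray_self, re_inner_ray_self] at this
  · rw [re_inner_ray, re_inner_ray]
    gcongr

theorem ray_le_scalar_iff {s t : unitInterval} {x : sphere (0 : H) 1} :
    ray s x ≤ scalar t ↔ s ≤ t := by
  refine ⟨fun h => ?_, fun h => le_iff.2 fun y => ?_⟩
  · have := le_iff.1 h x
    rw [re_inner_ray_self, re_inner_scalar] at this
    simpa using this
  · rw [re_inner_ray, re_inner_scalar]
    have h1 : ‖⟪(x : H), y⟫‖ ≤ ‖y‖ := by simpa using norm_inner_le_norm (𝕜 := ℂ) (x : H) y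
    gcongr
    exact t.2.1

theorem exists_eq_ray_of_apply_eq_zero {A : Effect H} {x : sphere (0 : H) 1}
    (h0 : ∀ z, ⟪(x : H), z⟫ = 0 → A.1 z = 0) : ∃ s, A = ray s x := by
  have hx : ‖(x : H)‖ = 1 := by simp
  have h1 := A.re_inner_le x
  rw [hx, one_pow] at h1
  let s : unitInterval := ⟨(⟪A.1 x, (x : H)⟫).re, A.re_inner_nonneg x, h1⟩
  have horth : ∀ y : H, ⟪(x : H), y - ⟪(x : H), y⟫ • (x : H)⟫ = 0 := fun y => by
    rw [inner_sub_right, inner_smul_right, inner_coe_self, mul_one, sub_self]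
  -- The component `w` of `A x` orthogonal to `x` is killed by `A`, so `⟨w, w⟩ = ⟨A x, w⟩ = ⟨x, A w⟩
  -- = 0`.
  have hAx : A.1 x = ⟪(x : H), A.1 x⟫ • (x : H) := by
    have h2 := horth (A.1 x)
    set w := A.1 x - ⟪(x : H), A.1 x⟫ • (x : H) with hw
    rw [← sub_eq_zero, ← hw, ← inner_self_eq_zero (𝕜 := ℂ)]
    conv_lhs => rw [hw, inner_sub_left, inner_smul_left, h2, mul_zero, sub_zero, A.inner_symm,
      h0 _ h2, inner_zero_right]
  refine ⟨s, Subtype.ext (ContinuousLinearMap.ext fun y => ?_)⟩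
  rw [ray_apply]
  conv_lhs => rw [← sub_add_cancel y (⟪(x : H), y⟫ • (x : H)), map_add, h0 _ (horth y), zero_add,
    map_smul, hAx, ← A.inner_symm, A.inner_self_eq_re, smul_smul, mul_comm]

theorem exists_eq_ray_of_le_ray {A : Effect H} {t : unitInterval} {x : sphere (0 : H) 1}
    (h : A ≤ ray t x) : ∃ s ≤ t, A = ray s x := by
  obtain ⟨s, hs⟩ := exists_eq_ray_of_apply_eq_zero (A := A) (x := x) fun z hz => by
    refine A.apply_eq_zero_of_re_inner_eq_zero (le_antisymm ?_ (A.re_inner_nonneg z))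
    have := le_iff.1 h z
    rw [re_inner_ray, hz] at this
    simpa using this
  exact ⟨s, ray_le_ray_iff.1 (hs ▸ h), hs⟩

theorem exists_smul_of_ray_eq_ray {s t : unitInterval} {x y : sphere (0 : H) 1} (hs : s ≠ 0)
    (h : ray s x = ray t y) : ∃ c : ℂ, c ≠ 0 ∧ (x : H) = c • (y : H) := by
  have h1 : (ray s x).1 x = (ray t y).1 x := by rw [h]
  have hs' : (s : ℂ) ≠ 0 := by
    simpa using hs
  rw [ray_apply, ray_apply, inner_coe_self, mul_one, ← eq_inv_smul_iff₀ hs', smul_smul] at h1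
  refine ⟨_, fun h0 => ?_, h1⟩
  rw [h0, zero_smul] at h1
  exact ne_zero_of_mem_unit_sphere x h1

/-- A multiple of a minimal projection is the infimum of a scalar and the projection. -/
theorem isGLB_ray (t : unitInterval) (x : sphere (0 : H) 1) :
    IsGLB {(scalar t : Effect H), ray 1 x} (ray t x) := by
  constructor
  · rintro B (rfl | rfl)
    · exact ray_le_scalar_iff.2 le_rfl
    · exact ray_le_ray_iff.2 unitInterval.le_one'
  · intro B hB
    obtain ⟨s, -, rfl⟩ := exists_eq_ray_of_le_ray (hB (Or.inr rfl))
    exact ray_le_ray_iff.2 (ray_le_scalar_iff.1 (hB (Or.inl rfl)))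

/-- The rank-one form `y ↦ |⟨A x, y⟩|² / ⟨A x, x⟩` lies below that of `A` by Cauchy-Schwarz and
touches it at `x`. -/
theorem exists_ray_le (A : Effect H) {x : H} (hx : 0 < (⟪A.1 x, x⟫).re) :
    ∃ (s : unitInterval) (u : sphere (0 : H) 1), ray s u ≤ A ∧
      (⟪(ray s u).1 x, x⟫).re = (⟪A.1 x, x⟫).re ∧ ∃ c : ℂ, c ≠ 0 ∧ A.1 x = c • (u : H) := by
  set r := (⟪A.1 x, x⟫).re with hr
  have hAx : A.1 x ≠ 0 := fun h => by rw [hr, h] at hx; simp at hx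
  set n := ‖A.1 x‖ with hn
  have hn0 : 0 < n := norm_pos_iff.2 hAx
  -- Cauchy-Schwarz at `x` and `A x`, with `A ≤ 1`, gives `n⁴ ≤ r n²`.
  have hs1 : n ^ 2 ≤ r := by
    have h1 := A.norm_inner_sq_le x (A.1 x)
    have h2 := A.re_inner_le (A.1 x)
    rw [norm_inner_self_eq_norm_mul_norm, ← hn] at h1
    rw [← hn] at h2
    have h3 : n ^ 2 * n ^ 2 ≤ r * n ^ 2 := by nlinarith
    exact le_of_mul_le_mul_right h3 (by positivity)
  let s : unitInterval := ⟨n ^ 2 / r, by positivity, (div_le_one hx).2 hs1⟩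
  let u : sphere (0 : H) 1 := ⟨((n : ℂ)⁻¹) • A.1 x, by
    rw [mem_sphere_zero_iff_norm, norm_smul, norm_inv, norm_real, Real.norm_of_nonneg hn0.le, ← hn,
      inv_mul_cancel₀ hn0.ne']⟩
  have hform : ∀ y, (⟪(ray s u).1 y, y⟫).re = ‖⟪A.1 x, y⟫‖ ^ 2 / r := fun y => by
    rw [re_inner_ray]
    change n ^ 2 / r * ‖⟪((n : ℂ)⁻¹) • A.1 x, y⟫‖ ^ 2 = _
    rw [inner_smul_left, norm_mul, RCLike.norm_conj, norm_inv, norm_real,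
      Real.norm_of_nonneg hn0.le]
    field_simp
  refine ⟨s, u, le_iff.2 fun y => ?_, ?_, n, by exact_mod_cast hn0.ne', ?_⟩
  · rw [hform, div_le_iff₀ hx, mul_comm]
    exact A.norm_inner_sq_le x y
  · rw [hform, A.inner_self_eq_re, ← hr, norm_real, Real.norm_of_nonneg hx.le]
    field_simp
  · change A.1 x = (n : ℂ) • ((n : ℂ)⁻¹) • A.1 x
    rw [smul_inv_smul₀]
    exact_mod_cast hn0.ne'

/-- An effect is determined by the multiples of minimal projections below it. -/
theorem le_of_forall_ray_le {A B : Effect H} (h : ∀ s u, ray s u ≤ A → ray s u ≤ B) : A ≤ B := by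
  refine le_iff.2 fun x => ?_
  rcases (A.re_inner_nonneg x).eq_or_lt with h0 | h0
  · rw [← h0]; exact B.re_inner_nonneg x
  · obtain ⟨s, u, hle, heq, -⟩ := A.exists_ray_le h0
    rw [← heq]
    exact le_iff.1 (h s u hle) x

/-- In a chain, the touching rays obtained at different vectors are comparable, hence on one line.
That line contains the range of `A`, so `A` vanishes on its orthogonal complement. -/
theorem isChain_Iic_iff [Nontrivial H] (A : Effect H) :
    IsChain (· ≤ ·) (Set.Iic A) ↔ ∃ t u, A = ray t u := by
  constructor
  · intro hA
    by_cases h0 : ∃ x, 0 < (⟪A.1 x, x⟫).re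
    · obtain ⟨x, hx⟩ := h0
      obtain ⟨s, u, hle, hxform, -⟩ := A.exists_ray_le hx
      have hrange : ∀ y, ∃ d : ℂ, A.1 y = d • (u : H) := by
        intro y
        rcases (A.re_inner_nonneg y).eq_or_lt with hy | hy
        · exact ⟨0, by rw [A.apply_eq_zero_of_re_inner_eq_zero hy.symm, zero_smul]⟩
        obtain ⟨s', u', hle', hform, d, hd, hyu⟩ := A.exists_ray_le hy
        have key : ∀ {s : unitInterval} {u : sphere (0 : H) 1} {z : H}, 0 < (⟪A.1 z, z⟫).re →
            (⟪(ray s u).1 z, z⟫).re = (⟪A.1 z, z⟫).re → s ≠ 0 := by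
          rintro s u z hz h rfl
          rw [re_inner_ray] at h
          simp only [Set.Icc.coe_zero, zero_mul] at h
          exact hz.ne h
        have : ∃ b : ℂ, (u' : H) = b • (u : H) := by
          rcases hA.total hle hle' with h | h
          · obtain ⟨p, -, hp⟩ := exists_eq_ray_of_le_ray h
            obtain ⟨b, hb, hu⟩ := exists_smul_of_ray_eq_ray (key hx hxform) hp
            exact ⟨b⁻¹, by rw [hu, inv_smul_smul₀ hb]⟩
          · obtain ⟨p, -, hp⟩ := exists_eq_ray_of_le_ray h
            obtain ⟨b, -, hu⟩ := exists_smul_of_ray_eq_ray (key hy hform) hp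
            exact ⟨b, hu⟩
        obtain ⟨b, hb⟩ := this
        exact ⟨d * b, by rw [hyu, hb, smul_smul]⟩
      obtain ⟨t, ht⟩ := exists_eq_ray_of_apply_eq_zero (A := A) (x := u) fun z hz => by
        obtain ⟨d, hd⟩ := hrange z
        refine A.apply_eq_zero_of_re_inner_eq_zero ?_
        rw [hd, inner_smul_left, hz, mul_zero, zero_re]
      exact ⟨t, u, ht⟩
    · push Not at h0
      obtain ⟨u, hu⟩ := NormedSpace.sphere_nonempty (E := H) (x := 0) (r := 1) |>.2 zero_le_one
      refine ⟨0, ⟨u, hu⟩, ext_form fun x => ?_⟩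
      rw [re_inner_ray]
      simpa using le_antisymm (h0 x) (A.re_inner_nonneg x)
  · rintro ⟨t, u, rfl⟩ B hB C hC -
    obtain ⟨s, -, rfl⟩ := exists_eq_ray_of_le_ray hB
    obtain ⟨s', -, rfl⟩ := exists_eq_ray_of_le_ray hC
    simp only [ray_le_ray_iff]
    exact le_total _ _

end Effect

end Effects

/-! ### Coexistence of rank-one effects, and the scalars -/

section Coexistence

open Complex ComplexConjugate Metric

variable {H : Type*} [NormedAddCommGroup H] [InnerProductSpace ℂ H]

local notation "⟪" x ", " y "⟫" => inner ℂ x y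

namespace Effect

theorem norm_inner_eq_one_iff {x y : sphere (0 : H) 1} :
    ‖⟪(x : H), (y : H)⟫‖ = 1 ↔ ∃ c : ℂ, ‖c‖ = 1 ∧ (y : H) = c • (x : H) := by
  constructor
  · intro h
    exact exists_unit_smul_of_norm_inner_eq (by simp) (by simp [h])
  · rintro ⟨c, hc, h⟩
    rw [h, inner_smul_right, inner_coe_self, mul_one, hc]

theorem norm_sq_smul_add (z x : H) (a : ℂ) :
    ‖z - a • x‖ ^ 2 = ‖z‖ ^ 2 - 2 * (a * ⟪z, x⟫).re + ‖a‖ ^ 2 * ‖x‖ ^ 2 := by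
  rw [@norm_sub_sq ℂ, inner_smul_right, norm_smul, mul_pow]
  rfl

theorem norm_sq_sub_inner_smul (x : sphere (0 : H) 1) (z : H) :
    ‖z - ⟪(x : H), z⟫ • (x : H)‖ ^ 2 = ‖z‖ ^ 2 - ‖⟪(x : H), z⟫‖ ^ 2 := by
  have h : (⟪(x : H), z⟫ * ⟪z, (x : H)⟫).re = ‖⟪(x : H), z⟫‖ ^ 2 := by
    rw [← inner_conj_symm z, mul_conj, ofReal_re, normSq_eq_norm_sq]
  rw [norm_sq_smul_add, h]
  simp
  ring

/-- Positivity of the Gram determinant of `x`, `y`, `z`, with the phases discarded. -/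
theorem gram_le (x y : sphere (0 : H) 1) (z : H) :
    ‖⟪(x : H), z⟫‖ ^ 2 + ‖⟪(y : H), z⟫‖ ^ 2
        - 2 * ‖⟪(x : H), (y : H)⟫‖ * ‖⟪(x : H), z⟫‖ * ‖⟪(y : H), z⟫‖
      ≤ (1 - ‖⟪(x : H), (y : H)⟫‖ ^ 2) * ‖z‖ ^ 2 := by
  have h1 := norm_sq_sub_inner_smul x (y : H)
  have h2 := norm_sq_sub_inner_smul x z
  have h3 : ⟪(y : H) - ⟪(x : H), (y : H)⟫ • (x : H), z - ⟪(x : H), z⟫ • (x : H)⟫ =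
      ⟪(y : H), z⟫ - ⟪(x : H), z⟫ * conj ⟪(x : H), (y : H)⟫ := by
    rw [inner_sub_left, inner_sub_right, inner_sub_right, inner_smul_left, inner_smul_left,
      inner_smul_right, inner_smul_right, inner_coe_self, inner_conj_symm]
    ring
  -- Cauchy-Schwarz for the parts of `y` and `z` orthogonal to `x`; the reverse triangle inequality
  -- then removes the phases.
  have h4 := norm_inner_le_norm (𝕜 := ℂ) ((y : H) - ⟪(x : H), (y : H)⟫ • (x : H))
    (z - ⟪(x : H), z⟫ • (x : H))
  have h5 := abs_norm_sub_norm_le ⟪(y : H), z⟫ (⟪(x : H), z⟫ * conj ⟪(x : H), (y : H)⟫)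
  rw [← h3, norm_mul, RCLike.norm_conj] at h5
  have h6 := pow_le_pow_left₀ (abs_nonneg _) (h5.trans h4) 2
  rw [sq_abs, mul_pow, h1, h2] at h6
  have h7 : ‖(y : H)‖ = 1 := by simp
  rw [h7] at h6
  nlinarith

/-- The claim is positivity of the matrix with diagonal `p`, `r` and off-diagonal entries `-c`. Its
determinant is `1 - c ^ 2` times the slack in `h`. -/
theorem quadratic_form_nonneg {s t c a b : ℝ} (hs : 0 ≤ s) (hs1 : s ≤ 1) (hc : 0 ≤ c) (hc1 : c < 1)
    (h : s * t * c ^ 2 ≤ (1 - s) * (1 - t)) (ht : 0 ≤ t) (ht1 : t ≤ 1) :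
    (1 - c ^ 2) * (s * a ^ 2 + t * b ^ 2) ≤ a ^ 2 + b ^ 2 - 2 * c * a * b := by
  have hc2 : 0 < 1 - c ^ 2 := by nlinarith
  set p := 1 - s * (1 - c ^ 2) with hp
  set r := 1 - t * (1 - c ^ 2) with hr
  have hpr : c ^ 2 ≤ p * r := by
    have : p * r - c ^ 2 = (1 - c ^ 2) * ((1 - s) * (1 - t) - s * t * c ^ 2) := by
      rw [hp, hr]; ring
    nlinarith
  have hp0 : 0 ≤ p := by nlinarith [sq_nonneg c]
  have hr0 : 0 ≤ r := by nlinarith [sq_nonneg c]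
  suffices 0 ≤ p * a ^ 2 + r * b ^ 2 - 2 * c * a * b by rw [hp, hr] at this; nlinarith
  rcases hp0.eq_or_lt with h0 | h0
  · have : c = 0 := by rw [← h0] at hpr; nlinarith
    rw [this, ← h0]; nlinarith [mul_nonneg hr0 (sq_nonneg b)]
  · have h1 : p * (p * a ^ 2 + r * b ^ 2 - 2 * c * a * b) =
        (p * a - c * b) ^ 2 + (p * r - c ^ 2) * b ^ 2 := by ring
    have h2 : 0 ≤ p * (p * a ^ 2 + r * b ^ 2 - 2 * c * a * b) := by
      rw [h1]; exact add_nonneg (sq_nonneg _) (mul_nonneg (by linarith) (sq_nonneg _))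
    exact nonneg_of_mul_nonneg_right h2 h0

theorem forall_ray_form_le_iff {s t : unitInterval} {x y : sphere (0 : H) 1}
    (hxy : ‖⟪(x : H), (y : H)⟫‖ < 1) :
    (∀ z : H, (s : ℝ) * ‖⟪(x : H), z⟫‖ ^ 2 + t * ‖⟪(y : H), z⟫‖ ^ 2 ≤ ‖z‖ ^ 2) ↔
      (s : ℝ) * t * ‖⟪(x : H), (y : H)⟫‖ ^ 2 ≤ (1 - s) * (1 - t) := by
  set c := ‖⟪(x : H), (y : H)⟫‖ with hc
  have hc0 : 0 ≤ c := norm_nonneg _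
  constructor
  · intro h
    obtain ⟨hs0, hs1⟩ := s.2
    obtain ⟨ht0, ht1⟩ := t.2
    have hyx : ⟪(y : H), (x : H)⟫ * ⟪(x : H), (y : H)⟫ = (c ^ 2 : ℝ) := by
      rw [← inner_conj_symm (y : H), conj_mul', hc]; push_cast; rfl
    -- This is the extremal vector for `s P_x ≤ 1 - t P_y`: it satisfies `(1 - t P_y) z = (1 - t)
    -- x`.
    set z : H := (1 - t : ℂ) • (x : H) + (t * ⟪(y : H), (x : H)⟫ : ℂ) • (y : H) with hz
    set d : ℝ := (1 - t) + t * c ^ 2 with hd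
    have h1 : ⟪(x : H), z⟫ = (d : ℂ) := by
      rw [hz, inner_add_right, inner_smul_right, inner_smul_right, inner_coe_self, mul_assoc, hyx,
        hd]
      push_cast; ring
    have h2 : ⟪(y : H), z⟫ = ⟪(y : H), (x : H)⟫ := by
      rw [hz, inner_add_right, inner_smul_right, inner_smul_right, inner_coe_self]
      ring
    have h3 : ‖z‖ ^ 2 = t * c ^ 2 + (1 - t) * d := by
      have e1 : ⟪z, z⟫ = ((t * c ^ 2 + (1 - t) * d : ℝ) : ℂ) := by
        conv_lhs => rw [hz]
        rw [inner_add_left, inner_smul_left, inner_smul_left, h1, h2, map_mul, inner_conj_symm,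
          map_sub, conj_ofReal, map_one, mul_assoc (t : ℂ), mul_comm ⟪(x : H), (y : H)⟫, hyx]
        push_cast; ring
      have e2 := inner_self_eq_norm_sq (𝕜 := ℂ) z
      rw [← e2, e1, RCLike.re_to_complex, ofReal_re]
    have h4 := h z
    have hd0 : 0 ≤ d := by rw [hd]; nlinarith [mul_nonneg ht0 (sq_nonneg c)]
    rw [h1, h2, h3, norm_inner_symm, ← hc, norm_real, Real.norm_of_nonneg hd0] at h4
    have h5 : d * (s * d) ≤ d * (1 - t) := by nlinarith
    rcases hd0.eq_or_lt with h0 | h0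
    · have e1 : (t : ℝ) = 1 ∧ t * c ^ 2 = 0 := by
        constructor <;> nlinarith [mul_nonneg ht0 (sq_nonneg c)]
      rw [mul_assoc, e1.2, e1.1]; simp
    · have := le_of_mul_le_mul_left h5 h0
      rw [hd] at this
      nlinarith
  · intro h z
    have h1 := gram_le x y z
    have h2 := quadratic_form_nonneg (a := ‖⟪(x : H), z⟫‖) (b := ‖⟪(y : H), z⟫‖) s.2.1 s.2.2 hc0 hxy
      h t.2.1 t.2.2
    rw [← hc] at h1
    have hc2 : 0 < 1 - c ^ 2 := by nlinarith
    exact le_of_mul_le_mul_left (h2.trans h1) hc2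

variable [CompleteSpace H]

theorem ray_eq_of_norm_inner_eq_one {x y : sphere (0 : H) 1} (h : ‖⟪(x : H), (y : H)⟫‖ = 1)
    (t : unitInterval) : ray t x = ray t y := by
  obtain ⟨c, hc, hy⟩ := norm_inner_eq_one_iff.1 h
  refine ext_form fun z => ?_
  rw [re_inner_ray, re_inner_ray, hy, inner_smul_left, norm_mul, RCLike.norm_conj, hc, one_mul]

theorem ray_one_eq_iff {x y : sphere (0 : H) 1} :
    ray 1 x = ray 1 y ↔ ‖⟪(x : H), (y : H)⟫‖ = 1 := by
  refine ⟨fun h => ?_, fun h => ray_eq_of_norm_inner_eq_one h 1⟩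
  have h1 := re_inner_ray_self 1 y
  rw [← h, re_inner_ray] at h1
  simp only [Set.Icc.coe_one, one_mul] at h1
  exact (pow_eq_one_iff_of_nonneg (norm_nonneg _) two_ne_zero).1 h1

theorem exists_coe_eq_ray_add_ray {s t : unitInterval} {x y : sphere (0 : H) 1}
    (h : ∀ z : H, (s : ℝ) * ‖⟪(x : H), z⟫‖ ^ 2 + t * ‖⟪(y : H), z⟫‖ ^ 2 ≤ ‖z‖ ^ 2) :
    ∃ S : Effect H, S.1 = (ray s x).1 + (ray t y).1 := by
  refine ⟨ofForm ((ray s x).1 + (ray t y).1) (fun u v => ?_) (fun z => ?_) (fun z => ?_), rfl⟩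
  · rw [add_apply, add_apply, inner_add_left, inner_add_right, inner_symm, inner_symm]
  · rw [add_apply, inner_add_left, add_re]
    exact add_nonneg (re_inner_nonneg _ _) (re_inner_nonneg _ _)
  · rw [add_apply, inner_add_left, add_re, re_inner_ray, re_inner_ray]
    exact h z

/-- The common part `G` lies below multiples of two different projections, so it is zero and
coexistence means that the sum is at most 1. -/
theorem coexistent_ray_iff {s t : unitInterval} {x y : sphere (0 : H) 1}
    (hxy : ‖⟪(x : H), (y : H)⟫‖ < 1) :
    Coexistent (ray s x) (ray t y) ↔
      (s : ℝ) * t * ‖⟪(x : H), (y : H)⟫‖ ^ 2 ≤ (1 - s) * (1 - t) := by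
  rw [← forall_ray_form_le_iff hxy]
  constructor
  · rintro ⟨E, F, G, S, hE, hF, hS⟩ z
    have hGx : G ≤ ray s x := le_iff.2 fun z => by
      rw [hE, add_apply, inner_add_left, add_re]; linarith [E.re_inner_nonneg z]
    have hGy : G ≤ ray t y := le_iff.2 fun z => by
      rw [hF, add_apply, inner_add_left, add_re]; linarith [F.re_inner_nonneg z]
    obtain ⟨g, -, hg⟩ := exists_eq_ray_of_le_ray hGx
    obtain ⟨g', -, hg'⟩ := exists_eq_ray_of_le_ray hGy
    -- Evaluating `G = g P_x = g' P_y` at `x` and at `y` gives `g = g' c²` and `g' = g c²`, with `c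
    -- < 1`.
    have hg0 : (g : ℝ) = 0 := by
      have h1 := re_inner_ray_self g x
      have h2 := re_inner_ray_self g' y
      rw [← hg, hg', re_inner_ray, norm_inner_symm] at h1
      rw [← hg', hg, re_inner_ray] at h2
      rw [← h2] at h1
      have h3 : ‖⟪(x : H), (y : H)⟫‖ ^ 2 < 1 := by nlinarith [norm_nonneg ⟪(x : H), (y : H)⟫]
      have h4 : (g : ℝ) * (1 - ‖⟪(x : H), (y : H)⟫‖ ^ 2 * ‖⟪(x : H), (y : H)⟫‖ ^ 2) = 0 := by
        linarith
      refine (mul_eq_zero.1 h4).resolve_right ?_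
      nlinarith [sq_nonneg ‖⟪(x : H), (y : H)⟫‖]
    have hG : (⟪G.1 z, z⟫).re = 0 := by rw [hg, re_inner_ray, hg0, zero_mul]
    rw [← re_inner_ray, ← re_inner_ray, hE, hF]
    have h1 := S.re_inner_le z
    rw [hS] at h1
    simp only [add_apply, inner_add_left, add_re, hG] at h1 ⊢
    linarith
  · intro h
    have h0 : (ray 0 x).1 = 0 := ContinuousLinearMap.ext fun z => by rw [ray_apply]; simp
    obtain ⟨S, hS⟩ := exists_coe_eq_ray_add_ray h
    exact ⟨ray s x, ray t y, ray 0 x, S, by rw [h0, add_zero], by rw [h0, add_zero],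
      by rw [h0, add_zero, hS]⟩

theorem ray_one_le_of_apply_eq {A : Effect H} {x : sphere (0 : H) 1} (h : A.1 x = x) :
    ray 1 x ≤ A := le_iff.2 fun z => by
  have h1 := A.norm_inner_sq_le x z
  rw [h, inner_coe_self] at h1
  rw [re_inner_ray]
  simpa using h1

/-- `‖A x - x‖² = ‖A x‖² - 2 ⟨A x, x⟩ + 1`, which is at most 0. With the preceding lemma, `P_x ≤ A`
becomes the condition `A x = x`, which is linear in `x`. -/
theorem apply_eq_self_of_one_le {A : Effect H} {x : sphere (0 : H) 1}
    (h : 1 ≤ (⟪A.1 x, (x : H)⟫).re) : A.1 x = x := by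
  have h1 := A.norm_inner_sq_le x (A.1 x)
  have h2 := A.re_inner_le (A.1 x)
  have h3 := A.re_inner_le x
  have hx : ‖(x : H)‖ = 1 := by simp
  rw [hx, one_pow] at h3
  have h4 : (⟪A.1 x, (x : H)⟫).re = 1 := le_antisymm h3 h
  rw [norm_inner_self_eq_norm_mul_norm, h4, one_mul] at h1
  have h5 : ‖A.1 x‖ ^ 2 ≤ 1 := by
    by_contra! hlt
    nlinarith
  rw [← sub_eq_zero, ← norm_eq_zero, ← sq_eq_zero_iff, @norm_sub_sq ℂ, RCLike.re_to_complex, h4, hx]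
  refine le_antisymm (by linarith) ?_
  have h6 : ‖⟪A.1 x, (x : H)⟫‖ ≤ ‖A.1 x‖ * ‖(x : H)‖ := norm_inner_le_norm _ _
  rw [A.inner_self_eq_re, h4, hx] at h6
  simp only [ofReal_one, norm_one, mul_one] at h6
  nlinarith

theorem apply_eq_self_of_ray_one_le {A : Effect H} {x : sphere (0 : H) 1} (h : ray 1 x ≤ A) :
    A.1 x = x := by
  refine apply_eq_self_of_one_le ?_
  have := le_iff.1 h x
  rwa [re_inner_ray_self] at this

/-- The order-theoretic description of the line through `x` lying in the span of `y` and `z`. -/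
theorem forall_ray_one_le_iff {x y z : sphere (0 : H) 1} (hyz : ⟪(y : H), (z : H)⟫ = 0) :
    (∀ A, ray 1 y ≤ A → ray 1 z ≤ A → ray 1 x ≤ A) ↔
      ‖⟪(x : H), (y : H)⟫‖ ^ 2 + ‖⟪(x : H), (z : H)⟫‖ ^ 2 = 1 := by
  have hx : ‖(x : H)‖ = 1 := by simp
  have hbessel : ∀ v : H, ‖⟪(y : H), v⟫‖ ^ 2 + ‖⟪(z : H), v⟫‖ ^ 2 ≤ ‖v‖ ^ 2 := fun v => by
    have h := gram_le y z v
    rw [hyz] at h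
    simpa using h
  rw [norm_inner_symm, norm_inner_symm (x : H) (z : H)]
  constructor
  · intro h
    -- The projection `P_y + P_z` onto the span is the decisive upper bound.
    obtain ⟨S, hS⟩ := exists_coe_eq_ray_add_ray (s := 1) (t := 1) (x := y) (y := z)
      (by simpa using hbessel)
    have hform : ∀ v, (⟪S.1 v, v⟫).re = (⟪(ray 1 y).1 v, v⟫).re + (⟪(ray 1 z).1 v, v⟫).re :=
      fun v => by rw [hS, add_apply, inner_add_left, add_re]
    have h1 := le_iff.1 (h S (le_iff.2 fun v => by rw [hform]; linarith [re_inner_nonneg (ray 1 z) v])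
      (le_iff.2 fun v => by rw [hform]; linarith [re_inner_nonneg (ray 1 y) v])) x
    rw [hform, re_inner_ray_self, re_inner_ray, re_inner_ray] at h1
    simp only [Set.Icc.coe_one, one_mul] at h1
    have h2 := hbessel x
    rw [hx, one_pow] at h2
    exact le_antisymm h2 h1
  · intro h A hy hz
    have hy' := apply_eq_self_of_ray_one_le hy
    have hz' := apply_eq_self_of_ray_one_le hz
    -- Equality in Bessel's inequality puts `x` in the span of `y` and `z`, where `A` acts as the
    -- identity.
    have hxyz : (x : H) = ⟪(y : H), (x : H)⟫ • (y : H) + ⟪(z : H), (x : H)⟫ • (z : H) := by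
      set w := (x : H) - ⟪(y : H), (x : H)⟫ • (y : H) with hw
      have h1 : ⟪(z : H), w⟫ = ⟪(z : H), (x : H)⟫ := by
        rw [hw, inner_sub_right, inner_smul_right, inner_eq_zero_symm.1 hyz, mul_zero, sub_zero]
      have h2 := norm_sq_sub_inner_smul z w
      rw [h1, hw, norm_sq_sub_inner_smul y, hx] at h2
      have h3 : ‖(x : H) - ⟪(y : H), (x : H)⟫ • (y : H) - ⟪(z : H), (x : H)⟫ • (z : H)‖ ^ 2 = 0 := by
        rw [h2]; linarith
      have h4 := norm_eq_zero.1 (sq_eq_zero_iff.1 h3)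
      rw [sub_sub, sub_eq_zero] at h4
      exact h4
    apply ray_one_le_of_apply_eq
    conv_lhs => rw [hxyz, map_add, map_smul, map_smul, hy', hz', ← hxyz]

/-- Take `E = t (1 - B)`, `F = (1 - t) B`, `G = t B`; the sum is `t + (1 - t) B`. -/
theorem coexistent_scalar (t : unitInterval) (B : Effect H) : Coexistent (scalar t) B := by
  have hn : ∀ x : H, (⟪x, x⟫).re = ‖x‖ ^ 2 := fun x => inner_self_eq_norm_sq (𝕜 := ℂ) x
  obtain ⟨ht0, ht1⟩ := t.2
  let L : ℝ → ℝ → H →L[ℂ] H := fun p q => (p : ℂ) • (1 : H →L[ℂ] H) + (q : ℂ) • B.1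
  have hL : ∀ p q x, L p q x = (p : ℂ) • x + (q : ℂ) • B.1 x := fun _ _ _ => rfl
  have hsymm : ∀ p q x y, ⟪L p q x, y⟫ = ⟪x, L p q y⟫ := fun p q x y => by
    simp only [hL, inner_add_left, inner_add_right, inner_smul_left, inner_smul_right, conj_ofReal,
      B.inner_symm]
  have hform : ∀ p q x, (⟪L p q x, x⟫).re = p * ‖x‖ ^ 2 + q * (⟪B.1 x, x⟫).re := fun p q x => by
    simp only [hL, inner_add_left, inner_smul_left, conj_ofReal, add_re, re_ofReal_mul, hn]
  let E : ∀ p q : ℝ, 0 ≤ p → 0 ≤ p + q → p + q ≤ 1 → p ≤ 1 → Effect H := fun p q h1 h2 h3 h4 =>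
    ofForm (L p q) (hsymm p q)
      (fun x => by rw [hform]; nlinarith [B.re_inner_nonneg x, B.re_inner_le x])
      (fun x => by rw [hform]; nlinarith [B.re_inner_nonneg x, B.re_inner_le x])
  refine ⟨E t (-t) ht0 (by simp) (by simp) ht1, E 0 (1 - t) le_rfl (by linarith) (by linarith)
    zero_le_one, E 0 t le_rfl (by linarith) (by linarith) zero_le_one,
    E t (1 - t) ht0 (by linarith) (by linarith) ht1, ?_, ?_, ?_⟩
  all_goals
    refine ContinuousLinearMap.ext fun x => ?_
    simp only [E, ofForm, add_apply, hL, scalar_apply]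
    push_cast
    module

/-- Coexistence with `P_x` makes `x` an eigenvector: `G = g P_x`, so `F + G` has value 1 at `x`,
leaving `E x = 0` and `A x = g x`. An operator with only eigenvectors is scalar. -/
theorem exists_eq_scalar_of_forall_coexistent [Nontrivial H] {A : Effect H}
    (h : ∀ B, Coexistent A B) : ∃ t, A = scalar t := by
  have heig : ∀ x : sphere (0 : H) 1, ∃ c : ℂ, A.1 x = c • (x : H) := by
    intro x
    obtain ⟨E, F, G, S, hE, hF, hS⟩ := h (ray 1 x)
    have hGx : G ≤ ray 1 x := le_iff.2 fun z => by
      rw [hF, add_apply, inner_add_left, add_re]; linarith [F.re_inner_nonneg z]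
    obtain ⟨g, -, hg⟩ := exists_eq_ray_of_le_ray hGx
    have hFx : (⟪F.1 x, (x : H)⟫).re = 1 - g := by
      have h1 := re_inner_ray_self 1 x
      rw [hF, add_apply, inner_add_left, add_re, hg, re_inner_ray_self] at h1
      simp at h1
      linarith
    have hEx : E.1 x = 0 := by
      refine E.apply_eq_zero_of_re_inner_eq_zero (le_antisymm ?_ (E.re_inner_nonneg x))
      have h1 := S.re_inner_le x
      rw [hS] at h1
      simp only [add_apply, inner_add_left, add_re, hFx, hg, re_inner_ray_self] at h1
      simp at h1
      linarith
    refine ⟨g, ?_⟩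
    rw [hE, add_apply, hEx, zero_add, hg, ray_apply, inner_coe_self, mul_one]
  have heig' : ∀ x : H, ∃ c : ℂ, A.1 x = c • x := by
    intro x
    by_cases hx : x = 0
    · exact ⟨0, by simp [hx]⟩
    have hn : (‖x‖ : ℂ) ≠ 0 := by simpa using hx
    obtain ⟨c, hc⟩ := heig ⟨(‖x‖ : ℂ)⁻¹ • x, by simp [norm_smul, norm_ne_zero_iff.2 hx]⟩
    refine ⟨c, ?_⟩
    simp only [map_smul] at hc
    rw [smul_comm c, (smul_right_injective H (inv_ne_zero hn)).eq_iff] at hc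
    exact hc
  obtain ⟨c, hc⟩ := LinearMap.exists_eq_smul_id_of_forall_notLinearIndependent
    (f := (A.1 : H →ₗ[ℂ] H)) fun v hv => by
      obtain ⟨c, hc⟩ := heig' v
      have := LinearIndependent.pair_iff.1 hv c (-1) (by
        rw [ContinuousLinearMap.coe_coe, hc]; simp)
      simpa using this.2
  have hc' : ∀ x, A.1 x = c • x := fun x => by
    have := congrArg (fun f : H →ₗ[ℂ] H => f x) hc
    simpa using this
  obtain ⟨u, hu⟩ := NormedSpace.sphere_nonempty (E := H) (x := 0) (r := 1) |>.2 zero_le_one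
  have hform : ∀ x, (⟪A.1 x, x⟫).re = c.re * ‖x‖ ^ 2 := fun x => by
    rw [hc', inner_smul_left, inner_self_eq_norm_sq_to_K]
    simp [← ofReal_pow]
  have hu1 : ‖u‖ = 1 := by simpa using hu
  have h0 := A.re_inner_nonneg u
  have h1 := A.re_inner_le u
  rw [hform, hu1, one_pow, mul_one] at h0 h1
  exact ⟨⟨c.re, h0, h1⟩, ext_form fun x => by rw [hform, re_inner_scalar]⟩

end Effect

end Coexistence

/-! ### Unit vectors, conjugation by (anti)unitaries, and automorphisms -/

section StandardAutomorphism

open Complex ComplexConjugate Metric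

variable {H : Type*} [NormedAddCommGroup H] [InnerProductSpace ℂ H]

local notation "⟪" x ", " y "⟫" => inner ℂ x y

section UnitVectors

/-- The unit vector in the direction of `v`. -/
noncomputable def normalizedVector (v : H) (hv : v ≠ 0) : sphere (0 : H) 1 :=
  ⟨(‖v‖ : ℂ)⁻¹ • v, by simp [norm_smul, norm_ne_zero_iff.2 hv]⟩

theorem norm_smul_normalizedVector (v : H) (hv : v ≠ 0) :
    (‖v‖ : ℂ) • (normalizedVector v hv : H) = v :=
  smul_inv_smul₀ (by simpa using hv) v

theorem normalizedVector_coe (x : sphere (0 : H) 1) (hx : (x : H) ≠ 0) :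
    normalizedVector (x : H) hx = x := by
  refine Subtype.ext ?_
  change (‖(x : H)‖ : ℂ)⁻¹ • (x : H) = x
  simp

theorem nontrivial_of_two_le_rank (hH : 2 ≤ Module.rank ℂ H) : Nontrivial H := by
  by_contra h
  rw [not_nontrivial_iff_subsingleton] at h
  rw [rank_subsingleton'] at hH
  simp at hH

theorem exists_inner_eq_zero_of_two_le_rank (hH : 2 ≤ Module.rank ℂ H) :
    ∃ y z : sphere (0 : H) 1, ⟪(y : H), (z : H)⟫ = 0 := by
  have := nontrivial_of_two_le_rank hH
  obtain ⟨e, he⟩ := NormedSpace.sphere_nonempty (E := H) (x := 0) (r := 1) |>.2 zero_le_one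
  have h1 : ¬ Module.rank ℂ H ≤ 1 := fun h => by
    have := hH.trans h
    norm_num at this
  rw [rank_le_one_iff] at h1
  push Not at h1
  obtain ⟨v, hv⟩ := h1 e
  let y : sphere (0 : H) 1 := ⟨e, he⟩
  have hw : v - ⟪e, v⟫ • e ≠ 0 := fun h => hv _ (sub_eq_zero.1 h).symm
  refine ⟨y, normalizedVector _ hw, ?_⟩
  change ⟪(y : H), (‖v - ⟪(y : H), v⟫ • (y : H)‖ : ℂ)⁻¹ • (v - ⟪(y : H), v⟫ • (y : H))⟫ = 0
  rw [inner_smul_right, inner_sub_right, inner_smul_right, Effect.inner_coe_self, mul_one, sub_self,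
    mul_zero]

theorem exists_unit_norm_inner_sq_eq {y z : sphere (0 : H) 1} (hyz : ⟪(y : H), (z : H)⟫ = 0) {c : ℝ}
    (hc : c ∈ Set.Ioo (0 : ℝ) 1) :
    ∃ x : sphere (0 : H) 1, ‖⟪(x : H), (y : H)⟫‖ ^ 2 = c ∧ ‖⟪(x : H), (z : H)⟫‖ ^ 2 = 1 - c := by
  have hc' : 0 ≤ 1 - c := by linarith [hc.2]
  have hzy := inner_eq_zero_symm.1 hyz
  set x : H := (√c : ℂ) • (y : H) + (√(1 - c) : ℂ) • (z : H) with hx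
  have hxy : ⟪x, (y : H)⟫ = √c := by
    rw [hx, inner_add_left, inner_smul_left, inner_smul_left, hzy, Effect.inner_coe_self]; simp
  have hxz : ⟪x, (z : H)⟫ = √(1 - c) := by
    rw [hx, inner_add_left, inner_smul_left, inner_smul_left, hyz, Effect.inner_coe_self]; simp
  have hxx : ‖x‖ = 1 := by
    have h1 : ⟪x, x⟫ = 1 := by
      conv_lhs => rw [hx]
      rw [← hx, inner_add_right, inner_smul_right, inner_smul_right, hxy, hxz, ← ofReal_mul,
        ← ofReal_mul, Real.mul_self_sqrt hc.1.le, Real.mul_self_sqrt hc']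
      push_cast; ring
    have h2 := norm_inner_self_eq_norm_mul_norm x
    rw [h1, norm_one] at h2
    nlinarith [norm_nonneg x]
  refine ⟨⟨x, by simpa using hxx⟩, ?_, ?_⟩
  · change ‖⟪x, (y : H)⟫‖ ^ 2 = c
    rw [hxy, norm_real, Real.norm_eq_abs, sq_abs, Real.sq_sqrt hc.1.le]
  · change ‖⟪x, (z : H)⟫‖ ^ 2 = 1 - c
    rw [hxz, norm_real, Real.norm_eq_abs, sq_abs, Real.sq_sqrt hc']

/-- Wigner's theorem for maps of the unit sphere. -/
theorem wigner_sphere [Nontrivial H] {T : sphere (0 : H) 1 → sphere (0 : H) 1}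
    (hT : ∀ x y, ‖⟪(T x : H), (T y : H)⟫‖ = ‖⟪(x : H), (y : H)⟫‖)
    (hsurj : ∀ z : sphere (0 : H) 1, ∃ x, ‖⟪(T x : H), (z : H)⟫‖ = 1) :
    (∃ U : H ≃ₗᵢ[ℂ] H, ∀ x : sphere (0 : H) 1, ∃ c : ℂ, ‖c‖ = 1 ∧ U x = c • (T x : H)) ∨
      (∃ U : H ≃ₛₗᵢ[starRingEnd ℂ] H, ∀ x : sphere (0 : H) 1,
        ∃ c : ℂ, ‖c‖ = 1 ∧ U x = c • (T x : H)) := by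
  classical
  let T' : H → H := fun v => if hv : v = 0 then 0 else (‖v‖ : ℂ) • (T (normalizedVector v hv) : H)
  have hT'0 : T' 0 = 0 := by simp [T']
  have hT' : ∀ v (hv : v ≠ 0), T' v = (‖v‖ : ℂ) • (T (normalizedVector v hv) : H) := fun v hv => by
    simp [T', hv]
  have hT'c : ∀ x : sphere (0 : H) 1, T' x = T x := fun x => by
    rw [hT' x (ne_zero_of_mem_unit_sphere x), normalizedVector_coe]; simp
  obtain ⟨e, he⟩ := NormedSpace.sphere_nonempty (E := H) (x := 0) (r := 1) |>.2 zero_le_one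
  have h1 : ∀ v w, ‖⟪T' v, T' w⟫‖ = ‖⟪v, w⟫‖ := by
    intro v w
    by_cases hv : v = 0
    · simp [hv, hT'0]
    by_cases hw : w = 0
    · simp [hw, hT'0]
    conv_rhs => rw [← norm_smul_normalizedVector v hv, ← norm_smul_normalizedVector w hw,
      inner_smul_left, inner_smul_right, norm_mul, norm_mul]
    rw [hT' v hv, hT' w hw, inner_smul_left, inner_smul_right, norm_mul, norm_mul, hT]
  have h2 : ∀ z, ∃ (c : ℂ) (x : H), z = c • T' x := by
    intro z
    by_cases hz : z = 0
    · exact ⟨0, 0, by simp [hz]⟩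
    obtain ⟨x, hx⟩ := hsurj (normalizedVector z hz)
    obtain ⟨c, -, hc⟩ := Effect.norm_inner_eq_one_iff.1 hx
    exact ⟨‖z‖ * c, x, by rw [hT'c, mul_smul, ← hc, norm_smul_normalizedVector]⟩
  rcases wigner (by simpa using he) h1 h2 with ⟨U, hU⟩ | ⟨U, hU⟩
  · exact Or.inl ⟨U, fun x => by simpa [hT'c] using hU x⟩
  · exact Or.inr ⟨U, fun x => by simpa [hT'c] using hU x⟩

end UnitVectors

namespace Effect

section Conjugation

variable {σ σ' : ℂ →+* ℂ} [RingHomInvPair σ σ'] [RingHomInvPair σ' σ]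

/-- Real parts of inner products are determined by norms, so linear and conjugate-linear isometries
are treated alike. -/
theorem re_inner_map_map (U : H ≃ₛₗᵢ[σ] H) (x y : H) : (⟪U x, U y⟫).re = (⟪x, y⟫).re := by
  have h1 := @norm_add_sq ℂ _ _ _ _ x y
  have h2 := @norm_add_sq ℂ _ _ _ _ (U x) (U y)
  rw [← map_add, U.norm_map, U.norm_map, U.norm_map] at h2
  simp only [RCLike.re_to_complex] at h1 h2
  linarith

theorem re_inner_map_left (U : H ≃ₛₗᵢ[σ] H) (x y : H) : (⟪U x, y⟫).re = (⟪x, U.symm y⟫).re := by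
  rw [← re_inner_map_map U x, U.apply_symm_apply]

theorem inner_symm_of_re {T : H →L[ℂ] H} (h : ∀ x y, (⟪T x, y⟫).re = (⟪x, T y⟫).re) (x y : H) :
    ⟪T x, y⟫ = ⟪x, T y⟫ := by
  refine Complex.ext (h x y) ?_
  have := h x (I • y)
  rw [map_smul, inner_smul_right, inner_smul_right, I_mul_re, I_mul_re] at this
  exact neg_injective this

theorem norm_inner_map_map [RingHomIsometric σ] [RingHomIsometric σ'] (U : H ≃ₛₗᵢ[σ] H) (x y : H) :
    ‖⟪U x, U y⟫‖ = ‖⟪x, y⟫‖ := by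
  have h : ∀ {σ σ' : ℂ →+* ℂ} [RingHomInvPair σ σ'] [RingHomInvPair σ' σ] [RingHomIsometric σ]
      (U : H ≃ₛₗᵢ[σ] H) (x y : H), ‖⟪x, y⟫‖ ≤ ‖⟪U x, U y⟫‖ := by
    intro σ σ' _ _ _ U x y
    by_cases h0 : ⟪x, y⟫ = 0
    · rw [h0]; simp
    have hn : ‖⟪x, y⟫‖ ≠ 0 := norm_ne_zero_iff.2 h0
    -- The phase that makes `⟨x, c • y⟩` equal to its modulus, so that preservation of real parts
    -- suffices.
    set c : ℂ := (starRingEnd ℂ) ⟪x, y⟫ / ‖⟪x, y⟫‖ with hc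
    have hc1 : ‖c‖ = 1 := by
      rw [hc, norm_div, RCLike.norm_conj, norm_real, norm_norm, div_self hn]
    have h1 : ⟪x, c • y⟫ = (‖⟪x, y⟫‖ : ℂ) := by
      rw [inner_smul_right, hc, div_mul_eq_mul_div, conj_mul', sq, mul_div_assoc,
        div_self (by exact_mod_cast hn), mul_one]
    calc ‖⟪x, y⟫‖ = (⟪x, c • y⟫).re := by rw [h1, ofReal_re]
      _ = (⟪U x, U (c • y)⟫).re := (re_inner_map_map U _ _).symm
      _ ≤ ‖⟪U x, U (c • y)⟫‖ := re_le_norm _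
      _ = ‖⟪U x, U y⟫‖ := by
        rw [LinearIsometryEquiv.map_smulₛₗ, inner_smul_right, norm_mul, RingHomIsometric.norm_map,
          hc1, one_mul]
  refine le_antisymm ?_ (h U x y)
  simpa using h U.symm (U x) (U y)

variable [CompleteSpace H]

/-- The effect `U A U⁻¹`, for a (conjugate-)linear surjective isometry `U`. -/
noncomputable def conjBy (U : H ≃ₛₗᵢ[σ] H) (A : Effect H) : Effect H :=
  ofForm ((U.toContinuousLinearEquiv : H →SL[σ] H).comp
      (A.1.comp (U.symm.toContinuousLinearEquiv : H →SL[σ'] H)))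
    (inner_symm_of_re fun x y => by
      change (⟪U (A.1 (U.symm x)), y⟫).re = (⟪x, U (A.1 (U.symm y))⟫).re
      rw [re_inner_map_left, A.inner_symm, ← re_inner_map_map U, U.apply_symm_apply])
    (fun x => by
      change 0 ≤ (⟪U (A.1 (U.symm x)), x⟫).re
      rw [re_inner_map_left]
      exact A.re_inner_nonneg _)
    (fun x => by
      change (⟪U (A.1 (U.symm x)), x⟫).re ≤ _
      rw [re_inner_map_left, ← U.symm.norm_map x]
      exact A.re_inner_le _)

theorem conjBy_apply (U : H ≃ₛₗᵢ[σ] H) (A : Effect H) (x : H) :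
    (conjBy U A).1 x = U (A.1 (U.symm x)) := rfl

theorem conjBy_symm_conjBy (U : H ≃ₛₗᵢ[σ] H) (A : Effect H) : conjBy U.symm (conjBy U A) = A :=
  Subtype.ext (ContinuousLinearMap.ext fun x => by simp [conjBy_apply])

theorem conjBy_le_conjBy_iff (U : H ≃ₛₗᵢ[σ] H) {A B : Effect H} : conjBy U A ≤ conjBy U B ↔ A ≤ B := by
  have h : ∀ {σ σ' : ℂ →+* ℂ} [RingHomInvPair σ σ'] [RingHomInvPair σ' σ] (U : H ≃ₛₗᵢ[σ] H)
      {A B : Effect H}, A ≤ B → conjBy U A ≤ conjBy U B := fun U A B h => le_iff.2 fun x => by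
    rw [conjBy_apply, conjBy_apply, re_inner_map_left, re_inner_map_left]
    exact le_iff.1 h _
  exact ⟨fun hU => by simpa only [conjBy_symm_conjBy] using h U.symm hU, h U⟩

theorem coexistent_conjBy_iff (U : H ≃ₛₗᵢ[σ] H) {A B : Effect H} :
    Coexistent (conjBy U A) (conjBy U B) ↔ Coexistent A B := by
  have h : ∀ {σ σ' : ℂ →+* ℂ} [RingHomInvPair σ σ'] [RingHomInvPair σ' σ] (U : H ≃ₛₗᵢ[σ] H)
      {A B : Effect H}, Coexistent A B → Coexistent (conjBy U A) (conjBy U B) := by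
    rintro σ σ' _ _ U A B ⟨E, F, G, S, hE, hF, hS⟩
    refine ⟨conjBy U E, conjBy U F, conjBy U G, conjBy U S, ?_, ?_, ?_⟩ <;>
      refine ContinuousLinearMap.ext fun x => ?_
    · simp only [conjBy_apply, add_apply, hE, map_add]
    · simp only [conjBy_apply, add_apply, hF, map_add]
    · simp only [conjBy_apply, add_apply, hS, map_add]
  exact ⟨fun hU => by simpa only [conjBy_symm_conjBy] using h U.symm hU, h U⟩

theorem conjBy_ray [RingHomIsometric σ] [RingHomIsometric σ'] (U : H ≃ₛₗᵢ[σ] H) (t : unitInterval)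
    {x u : sphere (0 : H) 1} {c : ℂ} (hc : ‖c‖ = 1) (hu : U x = c • (u : H)) :
    conjBy U (ray t x) = ray t u := by
  refine ext_form fun y => ?_
  rw [conjBy_apply, re_inner_map_left, re_inner_ray, re_inner_ray, ← norm_inner_map_map U,
    U.apply_symm_apply, hu, inner_smul_left, norm_mul, RCLike.norm_conj, hc, one_mul]

end Conjugation

/-! ### Automorphisms for order and coexistence -/

section OrderIso

variable [CompleteSpace H] [Nontrivial H]

theorem exists_map_ray (e : Effect H ≃o Effect H) (t : unitInterval) (x : sphere (0 : H) 1) :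
    ∃ s u, e (ray t x) = ray s u := by
  rw [← isChain_Iic_iff]
  have h := (isChain_Iic_iff (ray t x)).2 ⟨t, x, rfl⟩
  intro A hA B hB hAB
  have hA' : e.symm A ≤ ray t x := e.symm_apply_le.2 hA
  have hB' : e.symm B ≤ ray t x := e.symm_apply_le.2 hB
  simpa using h hA' hB' (fun heq => hAB (e.symm.injective heq))

/-- The projections `P_x` are the maximal rays, and both `e` and `e.symm` map rays to rays. -/
theorem exists_map_ray_one (e : Effect H ≃o Effect H) (x : sphere (0 : H) 1) :
    ∃ u, e (ray 1 x) = ray 1 u := by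
  obtain ⟨s, u, hsu⟩ := exists_map_ray e 1 x
  obtain ⟨r, y, hry⟩ := exists_map_ray e.symm 1 u
  have h1 : ray 1 x ≤ ray r y := by
    rw [← hry, e.le_symm_apply, hsu]
    exact ray_le_ray_iff.2 unitInterval.le_one'
  obtain ⟨p, hpr, hp⟩ := exists_eq_ray_of_le_ray h1
  have hp1 : (1 : ℝ) ≤ p := by
    have h2 := re_inner_ray_self 1 x
    rw [hp, re_inner_ray] at h2
    have h3 : ‖⟪(y : H), (x : H)⟫‖ ^ 2 ≤ 1 := pow_le_one₀ (norm_nonneg _) (norm_inner_coe_le_one y x)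
    have h4 : (p : ℝ) * ‖⟪(y : H), (x : H)⟫‖ ^ 2 = 1 := h2
    nlinarith [p.2.1]
  have hp' : p = 1 := le_antisymm unitInterval.le_one' hp1
  have hr' : r = 1 := le_antisymm unitInterval.le_one' (hp' ▸ hpr)
  refine ⟨u, ?_⟩
  rw [hp, hp', ← e.apply_symm_apply (ray 1 u), hry, hr']

theorem scalar_le_scalar_iff {s t : unitInterval} : (scalar s : Effect H) ≤ scalar t ↔ s ≤ t := by
  obtain ⟨u, hu⟩ := NormedSpace.sphere_nonempty (E := H) (x := 0) (r := 1) |>.2 zero_le_one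
  rw [mem_sphere_zero_iff_norm] at hu
  refine ⟨fun h => ?_, fun h => le_iff.2 fun x => ?_⟩
  · have := le_iff.1 h u
    rw [re_inner_scalar, re_inner_scalar, hu, one_pow, mul_one, mul_one] at this
    exact this
  · rw [re_inner_scalar, re_inner_scalar]
    gcongr

theorem exists_map_scalar (e : Effect H ≃o Effect H)
    (hco : ∀ A B, Coexistent A B ↔ Coexistent (e A) (e B)) (t : unitInterval) :
    ∃ s, e (scalar t) = scalar s := by
  refine exists_eq_scalar_of_forall_coexistent fun B => ?_
  rw [← e.apply_symm_apply B, ← hco]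
  exact coexistent_scalar _ _

theorem exists_map_ray_of_coexistent (hH : 2 ≤ Module.rank ℂ H) (e : Effect H ≃o Effect H)
    (hco : ∀ A B, Coexistent A B ↔ Coexistent (e A) (e B)) :
    ∃ T : sphere (0 : H) 1 → sphere (0 : H) 1, (∀ t x, e (ray t x) = ray t (T x)) ∧
      (∀ x y, ‖⟪(T x : H), (T y : H)⟫‖ = ‖⟪(x : H), (y : H)⟫‖) ∧
      ∀ z : sphere (0 : H) 1, ∃ x, ‖⟪(T x : H), (z : H)⟫‖ = 1 := by
  choose T hT using exists_map_ray_one e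
  choose k hk using exists_map_scalar e hco
  -- Order isomorphisms preserve the infimum of `t • 1` and `P_x`.
  have hray : ∀ t x, e (ray t x) = ray (k t) (T x) := by
    intro t x
    have h := (e.isGLB_image').2 (isGLB_ray t x)
    rw [Set.image_pair, hk, hT] at h
    exact h.unique (isGLB_ray _ _)
  have hmono : ∀ s t, k s ≤ k t ↔ s ≤ t := fun s t => by
    rw [← scalar_le_scalar_iff (H := H), ← hk, ← hk, e.le_iff_le, scalar_le_scalar_iff]
  have hsurj : ∀ s, ∃ t, k t = s := by
    intro s
    obtain ⟨t, ht⟩ := exists_map_scalar e.symm (fun A B => by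
      rw [hco (e.symm A), e.apply_symm_apply, e.apply_symm_apply]) s
    refine ⟨t, ?_⟩
    have h1 : (scalar (k t) : Effect H) = scalar s := by rw [← hk, ← ht, e.apply_symm_apply]
    exact le_antisymm (scalar_le_scalar_iff.1 h1.le) (scalar_le_scalar_iff.1 h1.ge)
  have hone : ∀ x y : sphere (0 : H) 1, ‖⟪(T x : H), (T y : H)⟫‖ = 1 ↔ ‖⟪(x : H), (y : H)⟫‖ = 1 := fun x y => by
    rw [← ray_one_eq_iff, ← ray_one_eq_iff, ← hT, ← hT, e.injective.eq_iff]
  have hlt : ∀ x y : sphere (0 : H) 1, ‖⟪(x : H), (y : H)⟫‖ < 1 → ‖⟪(T x : H), (T y : H)⟫‖ < 1 := fun x y h =>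
    (norm_inner_coe_le_one _ _).lt_of_ne fun h' => h.ne ((hone x y).1 h')
  have hineq : ∀ x y : sphere (0 : H) 1, ‖⟪(x : H), (y : H)⟫‖ < 1 → ∀ s t : unitInterval,
      (s : ℝ) * t * ‖⟪(x : H), (y : H)⟫‖ ^ 2 ≤ (1 - s) * (1 - t) ↔
        (k s : ℝ) * k t * ‖⟪(T x : H), (T y : H)⟫‖ ^ 2 ≤ (1 - k s) * (1 - k t) := by
    intro x y hxy s t
    rw [← coexistent_ray_iff hxy, ← coexistent_ray_iff (hlt x y hxy), hco, hray, hray]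
  have hk1 : k 1 = 1 := by
    obtain ⟨t, ht⟩ := hsurj 1
    exact le_antisymm unitInterval.le_one' (ht ▸ (hmono t 1).2 unitInterval.le_one')
  have horth : ∀ x y : sphere (0 : H) 1, ⟪(x : H), (y : H)⟫ = 0 → ⟪(T x : H), (T y : H)⟫ = 0 := by
    intro x y hxy
    have h := (hineq x y (by rw [hxy]; simp) 1 1).1 (by rw [hxy]; simp)
    rw [hk1] at h
    simp only [Set.Icc.coe_one, one_mul, sub_self, mul_zero] at h
    simpa using h
  let k' : ℝ → ℝ := fun t => k (Set.projIcc 0 1 zero_le_one t)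
  have hk' : ∀ t (ht : t ∈ Set.Icc (0 : ℝ) 1), k' t = k ⟨t, ht⟩ := fun t ht => by
    simp only [k', Set.projIcc_of_mem _ ht]
  obtain ⟨y, z, hyz⟩ := exists_inner_eq_zero_of_two_le_rank hH
  have hid : ∀ t : unitInterval, k t = t := by
    have := eq_self_of_mul_mul_le_iff (k := k') (fun t _ => (k _).2)
      (fun s hs t ht hst => by
        rw [hk' s hs, hk' t ht]
        have h1 : ¬ k ⟨t, ht⟩ ≤ k ⟨s, hs⟩ := by
          rw [hmono]; exact not_le.2 hst
        exact not_le.1 h1)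
      (fun s hs => by
        obtain ⟨t, ht⟩ := hsurj ⟨s, hs⟩
        exact ⟨t, t.2, by rw [hk' t t.2, Subtype.coe_eta, ht]⟩)
      (fun c hc => by
        obtain ⟨x, hxy, hxz⟩ := exists_unit_norm_inner_sq_eq hyz hc
        refine ⟨‖⟪(T x : H), (T y : H)⟫‖ ^ 2, ‖⟪(T x : H), (T z : H)⟫‖ ^ 2, ?_, ?_, ?_⟩
        -- Lying in the span of `y` and `z` is an order relation, so it passes to the images, and
        -- the new probabilities again sum to 1.
        · rw [← forall_ray_one_le_iff (horth y z hyz)]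
          intro A hy hz
          rw [← hT, ← e.le_symm_apply] at hy hz ⊢
          exact (forall_ray_one_le_iff hyz).2 (by rw [hxy, hxz]; ring) _ hy hz
        · intro s hs t ht
          rw [hk' s hs, hk' t ht, ← hxy]
          refine hineq x y ?_ ⟨s, hs⟩ ⟨t, ht⟩
          refine lt_of_pow_lt_pow_left₀ 2 zero_le_one ?_
          rw [hxy, one_pow]; exact hc.2
        · intro s hs t ht
          rw [hk' s hs, hk' t ht, ← hxz]
          refine hineq x z ?_ ⟨s, hs⟩ ⟨t, ht⟩
          refine lt_of_pow_lt_pow_left₀ 2 zero_le_one ?_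
          rw [hxz, one_pow]; linarith [hc.1])
    intro t
    have h := this t t.2
    rw [hk' t t.2] at h
    exact Subtype.ext h
  refine ⟨T, fun t x => by rw [hray, hid], fun x y => ?_, fun u => ?_⟩
  -- Equal lines, where the coexistence criterion is unavailable, are covered by injectivity of `e`.
  · rcases (norm_inner_coe_le_one x y).eq_or_lt with h | h
    · rw [h, hone, h]
    · have := eq_of_mul_mul_le_iff (sq_nonneg ‖⟪(x : H), (y : H)⟫‖)
        (sq_nonneg ‖⟪(T x : H), (T y : H)⟫‖) (fun s hs t ht => by
        have := hineq x y h ⟨s, hs⟩ ⟨t, ht⟩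
        rwa [hid, hid] at this)
      exact ((sq_eq_sq₀ (norm_nonneg _) (norm_nonneg _)).1 this).symm
  · obtain ⟨x, hx⟩ := exists_map_ray_one e.symm u
    refine ⟨x, ?_⟩
    rw [← ray_one_eq_iff, ← hT, ← hx, e.apply_symm_apply]

/-- Every ray is the image under `e` of a ray, so `e A` and `conjBy U A` have the same rays below
them. -/
theorem eq_conjBy_of_map_ray {σ σ' : ℂ →+* ℂ} [RingHomInvPair σ σ'] [RingHomInvPair σ' σ]
    [RingHomIsometric σ] [RingHomIsometric σ'] (e : Effect H ≃o Effect H) (U : H ≃ₛₗᵢ[σ] H)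
    (h : ∀ t x, e (ray t x) = conjBy U (ray t x)) (A : Effect H) : e A = conjBy U A := by
  have key : ∀ s u, ray s u ≤ e A ↔ ray s u ≤ conjBy U A := by
    intro s u
    obtain ⟨t, x, htx⟩ := exists_map_ray e.symm s u
    have : e (ray t x) = ray s u := by rw [← htx, e.apply_symm_apply]
    rw [← this, e.le_iff_le, h, conjBy_le_conjBy_iff]
  exact le_antisymm (le_of_forall_ray_le fun s u => (key s u).1)
    (le_of_forall_ray_le fun s u => (key s u).2)

end OrderIso

end Effect

end StandardAutomorphism

theorem theorem1p2 {H : Type*} [NormedAddCommGroup H] [InnerProductSpace ℂ H] [CompleteSpace H]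
    (hH : 2 ≤ Module.rank ℂ H) :
    (∀ φ : Effect H → Effect H, Function.Bijective φ →
      (∀ A B : Effect H, A ≤ B ↔ φ A ≤ φ B) →
      (∀ A B : Effect H, Coexistent A B ↔ Coexistent (φ A) (φ B)) →
      IsStandardAutomorphism φ) ∧
    (∀ φ : Effect H → Effect H, IsStandardAutomorphism φ →
      (∀ A B : Effect H, A ≤ B ↔ φ A ≤ φ B) ∧
      (∀ A B : Effect H, Coexistent A B ↔ Coexistent (φ A) (φ B))) := by
  have := nontrivial_of_two_le_rank hH
  constructor
  · intro φ hφ hle hco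
    let e : Effect H ≃o Effect H :=
      { Equiv.ofBijective φ hφ with map_rel_iff' := fun {A B} => (hle A B).symm }
    obtain ⟨T, hray, hT, hsurj⟩ := Effect.exists_map_ray_of_coexistent hH e hco
    rcases wigner_sphere hT hsurj with ⟨U, hU⟩ | ⟨U, hU⟩
    · refine Or.inl ⟨U, fun A x => ?_⟩
      have h := Effect.eq_conjBy_of_map_ray e U (fun t x => by
        obtain ⟨c, hc, h⟩ := hU x
        rw [hray, Effect.conjBy_ray U t hc h]) A
      rw [← Effect.conjBy_apply, ← h]
      rfl
    · refine Or.inr ⟨U, fun A x => ?_⟩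
      have h := Effect.eq_conjBy_of_map_ray e U (fun t x => by
        obtain ⟨c, hc, h⟩ := hU x
        rw [hray, Effect.conjBy_ray U t hc h]) A
      rw [← Effect.conjBy_apply, ← h]
      rfl
  · rintro φ (⟨U, hU⟩ | ⟨U, hU⟩)
    · have h : ∀ A, φ A = Effect.conjBy U A := fun A =>
        Subtype.ext (ContinuousLinearMap.ext fun x => hU A x)
      exact ⟨fun A B => by rw [h, h, Effect.conjBy_le_conjBy_iff],
        fun A B => by rw [h, h, Effect.coexistent_conjBy_iff]⟩
    · have h : ∀ A, φ A = Effect.conjBy U A := fun A =>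
        Subtype.ext (ContinuousLinearMap.ext fun x => hU A x)
      exact ⟨fun A B => by rw [h, h, Effect.conjBy_le_conjBy_iff],
        fun A B => by rw [h, h, Effect.coexistent_conjBy_iff]⟩
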